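/- Let $C\subset\mathbb{R}^2$ be an $o$-symmetric plane convex body, i.e. a compact convex set with non-empty interior and $C=-C$. The $C$-distance of points $p,q$ is their distance in the norm whose unit disk is $C$, and the $C$-length of a curve is the supremum of the $C$-lengths of the polygonal curves inscribed in it (sums of $C$-distances of consecutive vertices). For points $p,q$ at $C$-distance at most $2$, the arc-distance $\mathrm{arc}_C(p,q)$ is the minimum of the $C$-lengths of the arcs with endpoints $p$ and $q$ (the one-point arc if $p=q$) that are contained in the boundary of some translate of $C$. The $C$-spindle $[p,q]_C$ is the intersection of all translates of $C$ that contain both $p$ and $q$. The body $C$ is smooth if it has exactly one supporting line at each of its boundary points. Let $x,y,z\in\mathbb{R}^2$ be points whose pairwise $C$-distances are at most $2$. Then the arc-distances $\mathrm{arc}_C(x,y)$, $\mathrm{arc}_C(y,z)$, $\mathrm{arc}_C(x,z)$ exist (the minima are attained and finite), and: 1. if $y\in\operatorname{int}\,[x,z]_C$, then $\mathrm{arc}_C(x,y)+\mathrm{arc}_C(y,z)\le \mathrm{arc}_C(x,z)$; 2. if $y\in\operatorname{bd}\,[x,z]_C$, then $\mathrm{arc}_C(x,y)+\mathrm{arc}_C(y,z)=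 \mathrm{arc}_C(x,z)$; 3. if $y\notin[x,z]_C$ and $C$ is smooth, then $\mathrm{arc}_C(x,y)+\mathrm{arc}_C(y,z)\ge \mathrm{arc}_C(x,z)$. -/

import Mathlib

open scoped Pointwise ENNReal

/-- The Euclidean plane. -/
abbrev Plane : Type := EuclideanSpace ℝ (Fin 2)

/-- `C` is an origin-symmetric plane convex body: a compact convex set with non-empty interior
such that `C = -C`. -/
structure IsSymmPlaneBody (C : Set Plane) : Prop where
  convex : Convex ℝ C
  isCompact : IsCompact C
  interior_nonempty : (interior C).Nonempty
  neg_eq : -C = C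

/-- The `C`-distance of two points: the distance in the norm with unit disk `C`. -/
noncomputable def bodyDist (C : Set Plane) (p q : Plane) : ℝ :=
  gauge C (q - p)

/-- The `C`-length of the curve `γ` restricted to the parameter interval `[a, b]`: the supremum of
the `C`-lengths of the inscribed polygonal curves `γ (u 0), γ (u 1), …, γ (u n)`. -/
noncomputable def bodyLength (C : Set Plane) (γ : ℝ → Plane) (a b : ℝ) : ℝ≥0∞ :=
  ⨆ P : ℕ × {u : ℕ → ℝ // Monotone u ∧ ∀ i, u i ∈ Set.Icc a b},
    ∑ i ∈ Finset.range P.1,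
      ENNReal.ofReal (bodyDist C (γ ((P.2 : ℕ → ℝ) i)) (γ ((P.2 : ℕ → ℝ) (i + 1))))

/-- The restriction of `γ` to `[a, b]` is a (simple) arc with endpoints `p` and `q` contained
in `S`. For `p = q` the only such arc is the one-point arc, with `a = b`. -/
def IsArcIn (S : Set Plane) (γ : ℝ → Plane) (a b : ℝ) (p q : Plane) : Prop :=
  a ≤ b ∧ ContinuousOn γ (Set.Icc a b) ∧ Set.InjOn γ (Set.Icc a b) ∧
    γ a = p ∧ γ b = q ∧ ∀ t ∈ Set.Icc a b, γ t ∈ S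

/-- The set of the `C`-lengths of the arcs with endpoints `p` and `q` that are contained in the
boundary of some translate of `C`. -/
def arcLengths (C : Set Plane) (p q : Plane) : Set ℝ≥0∞ :=
  {l | ∃ (v : Plane) (γ : ℝ → Plane) (a b : ℝ),
    IsArcIn (frontier (v +ᵥ C)) γ a b p q ∧ l = bodyLength C γ a b}

/-- The arc-distance of `p` and `q` with respect to `C`. -/
noncomputable def arcDist (C : Set Plane) (p q : Plane) : ℝ≥0∞ :=
  sInf (arcLengths C p q)

/-- The arc-distance of `p` and `q` is really a minimum, and a finite one. -/
def ArcDistAttained (C : Set Plane) (p q : Plane) : Prop :=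
  IsLeast (arcLengths C p q) (arcDist C p q) ∧ arcDist C p q ≠ ⊤

/-- The `C`-spindle of `p` and `q`: the intersection of all translates of `C` that contain `p`
and `q` (the whole plane if there is no such translate). -/
def spindle (C : Set Plane) (p q : Plane) : Set Plane :=
  ⋂ (v : Plane) (_ : p ∈ v +ᵥ C) (_ : q ∈ v +ᵥ C), v +ᵥ C

/-- `L` is a supporting line of `C` at the point `p` of `C`. -/
def IsSupportingLineAt (C : Set Plane) (p : Plane) (L : Set Plane) : Prop :=
  ∃ f : Plane →L[ℝ] ℝ, f ≠ 0 ∧ (∀ w ∈ C, f w ≤ f p) ∧ L = {w | f w = f p}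

/-- `C` is smooth: there is only one supporting line at each of its boundary points. -/
def IsSmoothBody (C : Set Plane) : Prop :=
  ∀ p ∈ frontier C, ∀ L₁ L₂ : Set Plane,
    IsSupportingLineAt C p L₁ → IsSupportingLineAt C p L₂ → L₁ = L₂

open Set Filter Topology Real

/-- The standard area form of the plane. -/
def area (a b : Plane) : ℝ := a 0 * b 1 - a 1 * b 0

lemma area_add_left (a b c : Plane) : area (a + b) c = area a c + area b c := by
  simp [area]; ring

lemma area_sub_left (a b c : Plane) : area (a - b) c = area a c - area b c := by
  simp [area]; ring

lemma area_neg_left (a b : Plane) : area (-a) b = -area a b := by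
  simp [area]; ring

lemma area_smul_left (r : ℝ) (a b : Plane) : area (r • a) b = r * area a b := by
  simp [area]; ring

lemma area_swap (a b : Plane) : area a b = -area b a := by
  simp [area]; ring

lemma area_self (a : Plane) : area a a = 0 := by
  simp [area]; ring

lemma area_add_right (a b c : Plane) : area a (b + c) = area a b + area a c := by
  simp [area]; ring

lemma area_sub_right (a b c : Plane) : area a (b - c) = area a b - area a c := by
  simp [area]; ring

lemma area_neg_right (a b : Plane) : area a (-b) = -area a b := by
  simp [area]; ring

lemma area_smul_right (r : ℝ) (a b : Plane) : area a (r • b) = r * area a b := by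
  simp [area]; ring

lemma area_zero_left (a : Plane) : area 0 a = 0 := by simp [area]

lemma area_mul_area (a b c d : Plane) :
    area a b * area c d = area a c * area b d - area a d * area b c := by
  simp [area]; ring

/-- Cramer's rule in the plane. -/
lemma area_smul_eq (a b w : Plane) : area a b • w = area w b • a + area a w • b := by
  ext i
  fin_cases i <;> simp [area] <;> ring

lemma eq_of_area_ne_zero {a b w : Plane} (h : area a b ≠ 0) :
    w = (area w b / area a b) • a + (area a w / area a b) • b := by
  have := area_smul_eq a b w
  calc w = (area a b)⁻¹ • (area a b • w) := by rw [smul_smul, inv_mul_cancel₀ h, one_smul]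
    _ = _ := by rw [this, smul_add, smul_smul, smul_smul]; congr 2 <;> ring

/-- The linear functional `w ↦ area w T`. -/
def areaRight (T : Plane) : Plane →ₗ[ℝ] ℝ where
  toFun w := area w T
  map_add' a b := area_add_left a b T
  map_smul' r a := by simp [area_smul_left]

@[simp] lemma areaRight_apply (T w : Plane) : areaRight T w = area w T := rfl

lemma exists_areaRight_eq (f : Plane →ₗ[ℝ] ℝ) : ∃ T, areaRight T = f := by
  refine ⟨!₂[-f (EuclideanSpace.single 1 1), f (EuclideanSpace.single 0 1)], ?_⟩
  ext w
  have hw : w = w 0 • EuclideanSpace.single 0 1 + w 1 • EuclideanSpace.single 1 1 := by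
    ext i; fin_cases i <;> simp
  conv_rhs => rw [hw]
  rw [map_add, map_smul, map_smul]
  simp [area]

/-- The seminorm `N` on the plane is a (continuous) norm. -/
structure IsPlaneNorm (N : Seminorm ℝ Plane) : Prop where
  continuous : Continuous N
  eq_zero : ∀ w, N w = 0 → w = 0

lemma IsPlaneNorm.pos {N : Seminorm ℝ Plane} (hN : IsPlaneNorm N) {w : Plane} (hw : w ≠ 0) :
    0 < N w :=
  lt_of_le_of_ne (apply_nonneg N w) fun h => hw (hN.eq_zero w h.symm)

lemma Seminorm.map_smul_nonneg {E : Type*} [AddCommGroup E] [Module ℝ E] (N : Seminorm ℝ E)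
    {r : ℝ} (hr : 0 ≤ r) (w : E) : N (r • w) = r * N w := by
  rw [map_smul_eq_mul, Real.norm_of_nonneg hr]

/-- Every vector is normed by a functional of norm at most one. -/
lemma exists_area_eq (N : Seminorm ℝ Plane) (y : Plane) :
    ∃ T, area y T = N y ∧ ∀ w, area w T ≤ N w := by
  obtain ⟨g, hg, hgN⟩ : ∃ g : Plane →ₗ[ℝ] ℝ, g y = N y ∧ ∀ w, g w ≤ N w := by
    by_cases hy : y = 0
    · exact ⟨0, by simp [hy], fun w => by simp⟩
    · obtain ⟨g, hg, hgN⟩ := exists_extension_of_le_sublinear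
        (LinearPMap.mkSpanSingleton (K := ℝ) y (N y) hy) N
        (fun r hr w => N.map_smul_nonneg hr.le w) (map_add_le_add N) (by
          rintro ⟨w, hw⟩
          obtain ⟨r, rfl⟩ := Submodule.mem_span_singleton.1 hw
          refine (LinearPMap.mkSpanSingleton'_apply y (N y) _ r hw).le.trans ?_
          simp only [map_smul_eq_mul, smul_eq_mul, RingHom.id_apply]
          exact mul_le_mul_of_nonneg_right (le_abs_self r) (apply_nonneg N y))
      refine ⟨g, ?_, hgN⟩
      have := hg ⟨y, Submodule.mem_span_singleton_self y⟩
      rw [this]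
      exact LinearPMap.mkSpanSingleton_apply ℝ ℝ hy (N y)
  obtain ⟨T, rfl⟩ := exists_areaRight_eq g
  exact ⟨T, hg, hgN⟩

/-- The Euclidean unit vector of angle `θ`. -/
noncomputable def angleVec (θ : ℝ) : Plane := !₂[cos θ, sin θ]

@[simp] lemma angleVec_zero (θ : ℝ) : angleVec θ 0 = cos θ := rfl
@[simp] lemma angleVec_one (θ : ℝ) : angleVec θ 1 = sin θ := rfl

lemma angleVec_ne_zero (θ : ℝ) : angleVec θ ≠ 0 := by
  intro h
  have h0 : cos θ = 0 := by rw [← angleVec_zero, h]; rfl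
  have h1 : sin θ = 0 := by rw [← angleVec_one, h]; rfl
  have := sin_sq_add_cos_sq θ
  simp [h0, h1] at this

lemma continuous_angleVec : Continuous angleVec := by
  refine (PiLp.continuous_toLp 2 _).comp (continuous_pi fun i => ?_)
  fin_cases i
  · exact continuous_cos
  · exact continuous_sin

lemma angleVec_add_pi (θ : ℝ) : angleVec (θ + π) = -angleVec θ := by
  ext i; fin_cases i <;> simp

lemma exists_angleVec (w : Plane) : ∃ r θ : ℝ, 0 ≤ r ∧ w = r • angleVec θ := by
  refine ⟨‖(⟨w 0, w 1⟩ : ℂ)‖, Complex.arg ⟨w 0, w 1⟩, norm_nonneg _, ?_⟩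
  ext i; fin_cases i
  · simp [Complex.norm_mul_cos_arg]
  · simp [Complex.norm_mul_sin_arg]

/-- The parametrization of the unit circle of `N` by the angle. -/
noncomputable def unitCurve (N : Seminorm ℝ Plane) (θ : ℝ) : Plane :=
  (N (angleVec θ))⁻¹ • angleVec θ

section unitCurve

variable {N : Seminorm ℝ Plane}

lemma norm_unitCurve (hN : IsPlaneNorm N) (θ : ℝ) : N (unitCurve N θ) = 1 := by
  have := hN.pos (angleVec_ne_zero θ)
  rw [unitCurve, N.map_smul_nonneg (by positivity), inv_mul_cancel₀ this.ne']

lemma unitCurve_add_pi (θ : ℝ) : unitCurve N (θ + π) = -unitCurve N θ := by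
  simp [unitCurve, angleVec_add_pi, map_neg_eq_map]

lemma unitCurve_add_two_pi (θ : ℝ) : unitCurve N (θ + 2 * π) = unitCurve N θ := by
  rw [two_mul, ← add_assoc, unitCurve_add_pi, unitCurve_add_pi, neg_neg]

lemma unitCurve_sub_pi (θ : ℝ) : unitCurve N (θ - π) = -unitCurve N θ := by
  have := unitCurve_add_pi (N := N) (θ - π)
  rw [sub_add_cancel] at this
  rw [this, neg_neg]

lemma unitCurve_add_int_mul (θ : ℝ) (k : ℤ) :
    unitCurve N (θ + k * (2 * π)) = unitCurve N θ :=
  (show Function.Periodic (unitCurve N) (2 * π) from unitCurve_add_two_pi).int_mul k θ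

lemma continuous_unitCurve (hN : IsPlaneNorm N) : Continuous (unitCurve N) :=
  ((hN.continuous.comp continuous_angleVec).inv₀
    fun θ => (hN.pos (angleVec_ne_zero θ)).ne').smul continuous_angleVec

lemma area_unitCurve (a b : ℝ) : area (unitCurve N a) (unitCurve N b) =
    (N (angleVec a))⁻¹ * (N (angleVec b))⁻¹ * sin (b - a) := by
  rw [unitCurve, unitCurve, area_smul_left, area_smul_right, sin_sub]
  simp [area]; ring

lemma area_unitCurve_nonneg (a b : ℝ) (h : a ≤ b) (h' : b ≤ a + π) :
    0 ≤ area (unitCurve N a) (unitCurve N b) := by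
  rw [area_unitCurve]
  have := sin_nonneg_of_nonneg_of_le_pi (sub_nonneg.2 h) (by linarith)
  have h1 := apply_nonneg N (angleVec a)
  have h2 := apply_nonneg N (angleVec b)
  positivity

lemma area_unitCurve_pos (hN : IsPlaneNorm N) (a b : ℝ) (h : a < b) (h' : b < a + π) :
    0 < area (unitCurve N a) (unitCurve N b) := by
  rw [area_unitCurve]
  have := sin_pos_of_pos_of_lt_pi (sub_pos.2 h) (by linarith)
  have h1 := hN.pos (angleVec_ne_zero a)
  have h2 := hN.pos (angleVec_ne_zero b)
  positivity

lemma area_unitCurve_nonpos (a b : ℝ) (h : a + π ≤ b) (h' : b ≤ a + 2 * π) :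
    area (unitCurve N a) (unitCurve N b) ≤ 0 := by
  have := area_unitCurve_nonneg (N := N) a (b - π) (by linarith) (by linarith)
  rw [unitCurve_sub_pi, area_neg_right] at this
  linarith

lemma area_unitCurve_neg (hN : IsPlaneNorm N) (a b : ℝ) (h : a + π < b) (h' : b < a + 2 * π) :
    area (unitCurve N a) (unitCurve N b) < 0 := by
  have := area_unitCurve_pos hN a (b - π) (by linarith) (by linarith)
  rw [unitCurve_sub_pi, area_neg_right] at this
  linarith

lemma exists_unitCurve (hN : IsPlaneNorm N) (w : Plane) (s : ℝ) :
    ∃ θ ∈ Ico s (s + 2 * π), w = N w • unitCurve N θ := by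
  obtain ⟨r, θ, hr, hw⟩ := exists_angleVec w
  have key : w = N w • unitCurve N θ := by
    have hp := hN.pos (angleVec_ne_zero θ)
    have : N w = r * N (angleVec θ) := by rw [hw, N.map_smul_nonneg hr]
    rw [this, unitCurve, smul_smul, mul_assoc, mul_inv_cancel₀ hp.ne', mul_one, ← hw]
  refine ⟨toIcoMod two_pi_pos s θ, toIcoMod_mem_Ico two_pi_pos s θ, ?_⟩
  have := unitCurve_add_int_mul (N := N) θ (-toIcoDiv two_pi_pos s θ)
  rw [toIcoMod, sub_eq_add_neg, zsmul_eq_mul, ← neg_mul, ← Int.cast_neg, this]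
  exact key

lemma unitCurve_injective (hN : IsPlaneNorm N) {a b : ℝ} (h : a ≤ b) (h' : b < a + 2 * π)
    (hab : unitCurve N a = unitCurve N b) : a = b := by
  have h0 : area (unitCurve N a) (unitCurve N b) = 0 := by rw [hab, area_self]
  by_contra hne
  have hlt : a < b := lt_of_le_of_ne h hne
  rcases lt_trichotomy b (a + π) with h1 | h1 | h1
  · exact (area_unitCurve_pos hN a b hlt h1).ne' h0
  · rw [h1, unitCurve_add_pi] at hab
    have h2 := norm_unitCurve hN a
    have h3 : (2 : ℝ) • unitCurve N a = 0 := by rw [two_smul]; nth_rw 2 [hab]; simp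
    rw [(smul_eq_zero.1 h3).resolve_left two_ne_zero, map_zero] at h2
    exact zero_ne_one h2
  · exact (area_unitCurve_neg hN a b h1 h').ne h0

end unitCurve

/-- `area · T` is a norm-one functional supporting the unit disk at `unitCurve N θ`; so `T` is the
counterclockwise direction of a supporting line there. -/
structure IsSupport (N : Seminorm ℝ Plane) (θ : ℝ) (T : Plane) : Prop where
  eq_one : area (unitCurve N θ) T = 1
  le : ∀ w, area w T ≤ N w

section support

variable {N : Seminorm ℝ Plane}

lemma exists_isSupport (hN : IsPlaneNorm N) (θ : ℝ) : ∃ T, IsSupport N θ T := by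
  obtain ⟨T, h, h'⟩ := exists_area_eq N (unitCurve N θ)
  exact ⟨T, by rw [h, norm_unitCurve hN], h'⟩

lemma IsSupport.abs_area_le {θ : ℝ} {T : Plane} (h : IsSupport N θ T) (w : Plane) :
    |area w T| ≤ N w :=
  abs_le.2 ⟨by have := h.le (-w); rw [area_neg_left, map_neg_eq_map] at this; linarith, h.le w⟩

lemma IsSupport.neg_le {θ : ℝ} {T : Plane} (h : IsSupport N θ T) (w : Plane) :
    -N w ≤ area w T := (abs_le.1 (h.abs_area_le w)).1

lemma IsSupport.le_one (hN : IsPlaneNorm N) {θ : ℝ} {T : Plane} (h : IsSupport N θ T) (φ : ℝ) :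
    area (unitCurve N φ) T ≤ 1 := norm_unitCurve hN φ ▸ h.le _

lemma IsSupport.neg_one_le (hN : IsPlaneNorm N) {θ : ℝ} {T : Plane} (h : IsSupport N θ T)
    (φ : ℝ) : -1 ≤ area (unitCurve N φ) T := norm_unitCurve hN φ ▸ h.neg_le _

lemma IsSupport.sub_pi {θ : ℝ} {T : Plane} (h : IsSupport N θ T) : IsSupport N (θ - π) (-T) :=
  ⟨by rw [unitCurve_sub_pi, area_neg_left, area_neg_right, neg_neg, h.eq_one],
    fun w => by rw [area_neg_right]; linarith [h.neg_le w]⟩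

lemma IsSupport.add_two_pi {θ : ℝ} {T : Plane} (h : IsSupport N θ T) :
    IsSupport N (θ + 2 * π) T := ⟨by rw [unitCurve_add_two_pi, h.eq_one], h.le⟩

/-- Between two points of the unit circle less than half a turn apart. -/
lemma exists_unitCurve_eq (hN : IsPlaneNorm N) {a b c : ℝ} (hab : a ≤ b) (hbc : b ≤ c)
    (hac : c < a + π) (hne : a < c) : ∃ α β : ℝ, 0 ≤ α ∧ 0 ≤ β ∧ 1 ≤ α + β ∧ β ≤ 1 + α ∧
      unitCurve N b = α • unitCurve N a + β • unitCurve N c := by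
  have hpos := area_unitCurve_pos hN a c hne hac
  have h := eq_of_area_ne_zero (w := unitCurve N b) hpos.ne'
  have h1 := area_unitCurve_nonneg (N := N) b c hbc (by linarith)
  have h2 := area_unitCurve_nonneg (N := N) a b hab (by linarith)
  set α := area (unitCurve N b) (unitCurve N c) / area (unitCurve N a) (unitCurve N c)
  set β := area (unitCurve N a) (unitCurve N b) / area (unitCurve N a) (unitCurve N c)
  have hα : 0 ≤ α := div_nonneg h1 hpos.le
  have hβ : 0 ≤ β := div_nonneg h2 hpos.le
  have na := norm_unitCurve hN a
  have nb := norm_unitCurve hN b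
  have nc := norm_unitCurve hN c
  refine ⟨α, β, hα, hβ, ?_, ?_, h⟩
  · have := map_add_le_add N (α • unitCurve N a) (β • unitCurve N c)
    rw [← h, N.map_smul_nonneg hα, N.map_smul_nonneg hβ, na, nb, nc] at this
    linarith
  · have := map_sub_le_add N (unitCurve N b) (α • unitCurve N a)
    rw [show unitCurve N b - α • unitCurve N a = β • unitCurve N c by rw [h]; abel,
      N.map_smul_nonneg hα, N.map_smul_nonneg hβ, na, nb, nc] at this
    linarith

/-- A supporting functional decreases along the half circle after its support point. -/
lemma IsSupport.antitoneOn (hN : IsPlaneNorm N) {θ : ℝ} {T : Plane} (h : IsSupport N θ T)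
    {a b : ℝ} (ha : θ ≤ a) (hab : a ≤ b) (hb : b ≤ θ + π) :
    area (unitCurve N b) T ≤ area (unitCurve N a) T := by
  rcases hb.lt_or_eq with hb | rfl
  · rcases (ha.trans hab).lt_or_eq with hθ | rfl
    · obtain ⟨α, β, hα, hβ, h1, h2, he⟩ := exists_unitCurve_eq hN ha hab hb hθ
      have hle := h.le_one hN b
      have hge := h.neg_one_le hN b
      rw [he, area_add_left, area_smul_left, area_smul_left, h.eq_one]
      rcases le_total β 1 with hb1 | hb1 <;> nlinarith
    · rw [le_antisymm hab ha]
  · rw [unitCurve_add_pi, area_neg_left, h.eq_one]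
    exact h.neg_one_le hN a

/-- A supporting functional increases along the half circle before its support point. -/
lemma IsSupport.monotoneOn (hN : IsPlaneNorm N) {θ : ℝ} {T : Plane} (h : IsSupport N θ T)
    {a b : ℝ} (ha : θ - π ≤ a) (hab : a ≤ b) (hb : b ≤ θ) :
    area (unitCurve N a) T ≤ area (unitCurve N b) T := by
  have := h.sub_pi.antitoneOn hN ha hab (by linarith)
  rw [area_neg_right, area_neg_right] at this
  linarith

lemma IsSupport.area_nonneg (hN : IsPlaneNorm N) {s t : ℝ} {S T : Plane} (hS : IsSupport N s S)
    (hT : IsSupport N t T) (hst : s < t) (hts : t < s + π) : 0 ≤ area S T := by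
  have hpos := area_unitCurve_pos hN s t hst hts
  have key := area_mul_area (unitCurve N s) (unitCurve N t) S T
  rw [hS.eq_one, hT.eq_one] at key
  have h1 := hT.abs_area_le (unitCurve N s)
  have h2 := hS.abs_area_le (unitCurve N t)
  rw [norm_unitCurve hN] at h1 h2
  have h3 : area (unitCurve N s) T * area (unitCurve N t) S ≤ 1 :=
    (le_abs_self _).trans (by rw [abs_mul]; exact mul_le_one₀ h1 (abs_nonneg _) h2)
  by_contra hneg
  push Not at hneg
  nlinarith

/-- Parallel supporting lines: the supporting lines coincide or are opposite. -/
lemma IsSupport.eq_or_eq_neg (hN : IsPlaneNorm N) {s t : ℝ} {S T : Plane} (hS : IsSupport N s S)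
    (hT : IsSupport N t T) (h : area S T = 0) : T = S ∨ T = -S := by
  have e1 := area_smul_eq (unitCurve N s) S T
  rw [hS.eq_one, one_smul, area_swap T S, h, neg_zero, zero_smul, zero_add] at e1
  have e2 := area_smul_eq (unitCurve N t) T S
  rw [hT.eq_one, one_smul, h, zero_smul, zero_add] at e2
  set κ := area (unitCurve N s) T
  set μ := area (unitCurve N t) S
  have h1 : |κ| ≤ 1 := (hT.abs_area_le _).trans_eq (norm_unitCurve hN s)
  have h2 : |μ| ≤ 1 := (hS.abs_area_le _).trans_eq (norm_unitCurve hN t)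
  have h3 : κ * μ = 1 := by
    have : area (unitCurve N t) T = κ * μ := by
      conv_lhs => rw [e1]
      rw [area_smul_right]
    rw [← this, hT.eq_one]
  rw [abs_le] at h1 h2
  have h4 : (κ - 1) * (κ + 1) = 0 := by
    have k1 : κ ^ 2 ≤ 1 := by nlinarith
    have k2 : μ ^ 2 ≤ 1 := by nlinarith
    have k3 : κ ^ 2 * μ ^ 2 = 1 := by rw [← mul_pow, h3, one_pow]
    nlinarith [mul_le_mul_of_nonneg_left k2 (sq_nonneg κ)]
  rcases mul_eq_zero.1 h4 with h4 | h4
  · left; rw [e1, show κ = 1 by linarith, one_smul]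
  · right; rw [e1, show κ = -1 by linarith, neg_one_smul]

lemma IsSupport.eq_of_area_eq_zero (hN : IsPlaneNorm N) {s t : ℝ} {S T : Plane}
    (hS : IsSupport N s S) (hT : IsSupport N t T) (h : area S T = 0)
    (hd : N (unitCurve N t - unitCurve N s) < 2) : T = S := by
  refine (hS.eq_or_eq_neg hN hT h).resolve_right fun h' => ?_
  have h1 := hT.le (unitCurve N t - unitCurve N s)
  rw [area_sub_left, hT.eq_one, h', area_neg_right, hS.eq_one] at h1
  linarith

/-- The functional with the values `N S` at `S` and `N T` at `T`. -/
noncomputable def normInterp (N : Seminorm ℝ Plane) (S T : Plane) : Plane →ₗ[ℝ] ℝ :=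
  (N S / area S T) • areaRight T - (N T / area S T) • areaRight S

lemma normInterp_apply (S T w : Plane) :
    normInterp N S T w = N S / area S T * area w T - N T / area S T * area w S := by
  simp [normInterp]

lemma le_normInterp {S T w : Plane} (hST : 0 < area S T) (hS : area w S ≤ 0)
    (hT : 0 ≤ area w T) : N w ≤ normInterp N S T w := by
  have h := eq_of_area_ne_zero (w := w) hST.ne'
  have hβ : 0 ≤ area S w / area S T := div_nonneg (by rw [area_swap]; linarith) hST.le
  have := map_add_le_add N ((area w T / area S T) • S) ((area S w / area S T) • T)
  rw [← h, N.map_smul_nonneg (div_nonneg hT hST.le), N.map_smul_nonneg hβ, area_swap S w] at this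
  rw [normInterp_apply]
  refine this.trans (le_of_eq ?_)
  ring

lemma normInterp_le {S T w : Plane} (hST : 0 < area S T) (hw : 0 ≤ area w S ∨ area w T ≤ 0) :
    normInterp N S T w ≤ N w := by
  have h := eq_of_area_ne_zero (w := w) hST.ne'
  have e : normInterp N S T w = area w T / area S T * N S + area S w / area S T * N T := by
    rw [normInterp_apply, area_swap S w]; ring
  have h1 := apply_nonneg N S
  have h2 := apply_nonneg N T
  have h3 := apply_nonneg N w
  rw [e]
  set α := area w T / area S T with hα
  set β := area S w / area S T with hβ
  have hab : α ≤ 0 ∨ β ≤ 0 := by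
    rcases hw with hw | hw
    · right; rw [hβ, area_swap S w]; exact div_nonpos_of_nonpos_of_nonneg (by linarith) hST.le
    · left; exact div_nonpos_of_nonpos_of_nonneg hw hST.le
  rcases le_total α 0 with ha | ha <;> rcases le_total β 0 with hb | hb
  · nlinarith
  · have := map_add_le_add N w ((-α) • S)
    rw [show w + (-α) • S = β • T by rw [h]; module, N.map_smul_nonneg hb,
      N.map_smul_nonneg (neg_nonneg.2 ha)] at this
    linarith
  · have := map_add_le_add N w ((-β) • T)
    rw [show w + (-β) • T = α • S by rw [h]; module, N.map_smul_nonneg ha,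
      N.map_smul_nonneg (neg_nonneg.2 hb)] at this
    linarith
  · rcases hab with h0 | h0
    · rw [le_antisymm h0 ha] at h ⊢
      have : N w = β * N T := by conv_lhs => rw [h, zero_smul, zero_add, N.map_smul_nonneg hb]
      linarith
    · rw [le_antisymm h0 hb] at h ⊢
      have : N w = α * N S := by conv_lhs => rw [h, zero_smul, add_zero, N.map_smul_nonneg ha]
      linarith

/-- `u` dominates `N` on the chords of the arc from `s` to `t` and is dominated by `N` on the
chords of the complementary arc. -/
structure IsArcFunctional (N : Seminorm ℝ Plane) (s t : ℝ) (u : Plane →ₗ[ℝ] ℝ) : Prop where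
  le_on : ∀ a b, s ≤ a → a ≤ b → b ≤ t →
    N (unitCurve N b - unitCurve N a) ≤ u (unitCurve N b - unitCurve N a)
  on_le_first : ∀ a b, t ≤ a → a ≤ b → b ≤ t + π →
    u (unitCurve N b - unitCurve N a) ≤ N (unitCurve N b - unitCurve N a)
  on_le_second : ∀ a b, s + π ≤ a → a ≤ b → b ≤ s + 2 * π →
    u (unitCurve N b - unitCurve N a) ≤ N (unitCurve N b - unitCurve N a)

lemma IsSupport.isArcFunctional_normInterp (hN : IsPlaneNorm N) {s t : ℝ} {S T : Plane}
    (hS : IsSupport N s S) (hT : IsSupport N t T) (hts : t ≤ s + π)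
    (hpos : 0 < area S T) : IsArcFunctional N s t (normInterp N S T) where
  le_on a b ha hab hb := le_normInterp hpos
    (by rw [area_sub_left]; linarith [hS.antitoneOn hN ha hab (by linarith)])
    (by rw [area_sub_left]; linarith [hT.monotoneOn hN (by linarith) hab hb])
  on_le_first a b ha hab hb := normInterp_le hpos (Or.inr
    (by rw [area_sub_left]; linarith [hT.antitoneOn hN ha hab (by linarith)]))
  on_le_second a b ha hab hb := normInterp_le hpos (Or.inl
    (by rw [area_sub_left]
        linarith [hS.add_two_pi.monotoneOn hN (by linarith) hab (by linarith)]))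

/-- The functional of a straight arc. -/
lemma IsSupport.isArcFunctional_of_eq (hN : IsPlaneNorm N) {s t : ℝ} {T : Plane}
    (hS : IsSupport N s T) (hT : IsSupport N t T) (hts : t ≤ s + π) :
    ∃ u, IsArcFunctional N s t u ∧ ∀ w, u w ≤ N w := by
  obtain ⟨V, hV, hVN⟩ := exists_area_eq N T
  refine ⟨areaRight V, ⟨fun a b ha hab hb => ?_, fun a b _ _ _ => hVN _, fun a b _ _ _ => hVN _⟩,
    hVN⟩
  have h1 := hS.antitoneOn hN ha hab (by linarith)
  have h2 := hT.monotoneOn hN (by linarith) hab hb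
  have h3 : area (unitCurve N a) T = 1 := by
    have := hS.antitoneOn hN (le_refl s) ha (by linarith)
    have h7 := hT.monotoneOn hN (by linarith) ha (hab.trans hb)
    rw [hS.eq_one] at h7 this
    linarith
  have h0 : 0 ≤ area (unitCurve N a) (unitCurve N b) :=
    area_unitCurve_nonneg a b hab (by linarith)
  have e := area_smul_eq (unitCurve N a) T (unitCurve N b - unitCurve N a)
  have hz : area (unitCurve N b - unitCurve N a) T = 0 := by rw [area_sub_left]; linarith
  rw [h3, hz, one_smul, zero_smul, zero_add, area_sub_right, area_self, sub_zero] at e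
  rw [e, N.map_smul_nonneg h0, areaRight_apply, area_smul_left, hV]

end support

/-- The plane with the metric of the seminorm `N`. -/
def SeminormSpace (_N : Seminorm ℝ Plane) : Type := Plane

noncomputable instance (N : Seminorm ℝ Plane) : PseudoMetricSpace (SeminormSpace N) where
  dist a b := N ((show Plane from a) - (show Plane from b))
  dist_self a := (congrArg N (sub_self (show Plane from a))).trans (map_zero N)
  dist_comm a b := map_sub_rev N (show Plane from a) (show Plane from b)
  dist_triangle a b c := by
    have := map_add_le_add N ((show Plane from a) - (show Plane from b))
      ((show Plane from b) - (show Plane from c))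
    rwa [sub_add_sub_cancel] at this

lemma SeminormSpace.edist_eq (N : Seminorm ℝ Plane) (a b : Plane) :
    edist (α := SeminormSpace N) a b = ENNReal.ofReal (N (a - b)) :=
  edist_dist (α := SeminormSpace N) a b

/-- The length of a curve with respect to the seminorm `N`. -/
noncomputable def curveLength (N : Seminorm ℝ Plane) (γ : ℝ → Plane) (a b : ℝ) : ℝ≥0∞ :=
  eVariationOn (E := SeminormSpace N) γ (Icc a b)

section curveLength

variable {N : Seminorm ℝ Plane}

lemma curveLength_add (γ : ℝ → Plane) {a b c : ℝ} (hab : a ≤ b) (hbc : b ≤ c) :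
    curveLength N γ a b + curveLength N γ b c = curveLength N γ a c := by
  have := eVariationOn.Icc_add_Icc (E := SeminormSpace N) γ hab hbc (mem_univ b)
  rw [univ_inter, univ_inter, univ_inter] at this
  exact this

lemma ofReal_le_curveLength (γ : ℝ → Plane) {a b : ℝ} (hab : a ≤ b) :
    ENNReal.ofReal (N (γ b - γ a)) ≤ curveLength N γ a b := by
  rw [← SeminormSpace.edist_eq]
  exact eVariationOn.edist_le (E := SeminormSpace N) γ (right_mem_Icc.2 hab) (left_mem_Icc.2 hab)

lemma curveLength_le_of_linear (γ : ℝ → Plane) {a b : ℝ} (u : Plane →ₗ[ℝ] ℝ)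
    (h : ∀ s t, a ≤ s → s ≤ t → t ≤ b → N (γ t - γ s) ≤ u (γ t - γ s)) :
    curveLength N γ a b ≤ ENNReal.ofReal (u (γ b - γ a)) := by
  refine iSup_le ?_
  rintro ⟨n, v, hv, hvs⟩
  simp only [SeminormSpace.edist_eq]
  rw [← ENNReal.ofReal_sum_of_nonneg fun i _ => apply_nonneg N _]
  refine ENNReal.ofReal_le_ofReal ?_
  have h1 : ∑ i ∈ Finset.range n, N (γ (v (i + 1)) - γ (v i)) ≤
      ∑ i ∈ Finset.range n, (u (γ (v (i + 1))) - u (γ (v i))) :=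
    Finset.sum_le_sum fun i _ =>
      (h _ _ (hvs i).1 (hv i.le_succ) (hvs (i + 1)).2).trans_eq (map_sub u _ _)
  rw [Finset.sum_range_sub (fun i => u (γ (v i)))] at h1
  have h2 := (apply_nonneg N _).trans (h a (v 0) le_rfl (hvs 0).1 (hvs 0).2)
  have h3 := (apply_nonneg N _).trans (h (v n) b (hvs n).1 (hvs n).2 le_rfl)
  rw [map_sub] at h2 h3 ⊢
  linarith

lemma curveLength_eq_zero_of_eq (γ : ℝ → Plane) (a : ℝ) : curveLength N γ a a = 0 := by
  rw [curveLength, Icc_self]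
  exact eVariationOn.subsingleton (E := SeminormSpace N) γ subsingleton_singleton

lemma curveLength_congr {γ δ : ℝ → Plane} {a b : ℝ} (h : EqOn γ δ (Icc a b)) :
    curveLength N γ a b = curveLength N δ a b :=
  eVariationOn.congr (E := SeminormSpace N) h

lemma curveLength_congr_norm {γ δ : ℝ → Plane} {a b : ℝ}
    (h : ∀ s t, N (γ t - γ s) = N (δ t - δ s)) :
    curveLength N γ a b = curveLength N δ a b := by
  unfold curveLength eVariationOn
  simp only [SeminormSpace.edist_eq, h]

lemma curveLength_comp_monotone (γ : ℝ → Plane) {φ : ℝ → ℝ} {a b : ℝ} (hab : a ≤ b)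
    (hφ : MonotoneOn φ (Icc a b)) (hc : ContinuousOn φ (Icc a b)) :
    curveLength N (γ ∘ φ) a b = curveLength N γ (φ a) (φ b) := by
  have := eVariationOn.comp_eq_of_monotoneOn (E := SeminormSpace N) γ φ hφ
  rw [curveLength, curveLength]
  refine this.trans (congrArg _ (Subset.antisymm ?_ (intermediate_value_Icc hab hc)))
  rintro _ ⟨r, hr, rfl⟩
  exact ⟨hφ (left_mem_Icc.2 hab) hr hr.1, hφ hr (right_mem_Icc.2 hab) hr.2⟩

lemma curveLength_comp_antitone (γ : ℝ → Plane) {φ : ℝ → ℝ} {a b : ℝ} (hab : a ≤ b)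
    (hφ : AntitoneOn φ (Icc a b)) (hc : ContinuousOn φ (Icc a b)) :
    curveLength N (γ ∘ φ) a b = curveLength N γ (φ b) (φ a) := by
  have := eVariationOn.comp_eq_of_antitoneOn (E := SeminormSpace N) γ φ hφ
  rw [curveLength, curveLength]
  refine this.trans (congrArg _ (Subset.antisymm ?_ (intermediate_value_Icc' hab hc)))
  rintro _ ⟨r, hr, rfl⟩
  exact ⟨hφ hr (right_mem_Icc.2 hab) hr.2, hφ (left_mem_Icc.2 hab) hr hr.1⟩

lemma norm_angleVec_sub_le (N : Seminorm ℝ Plane) : ∃ K, 0 ≤ K ∧ ∀ a b : ℝ,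
    N (angleVec a - angleVec b) ≤ K * |a - b| := by
  refine ⟨N (EuclideanSpace.single 0 1) + N (EuclideanSpace.single 1 1), by positivity,
    fun a b => ?_⟩
  have e : angleVec a - angleVec b = (cos a - cos b) • EuclideanSpace.single 0 1 +
      (sin a - sin b) • EuclideanSpace.single 1 1 := by
    ext i; fin_cases i <;> simp
  have h := map_add_le_add N ((cos a - cos b) • EuclideanSpace.single 0 1 : Plane)
    ((sin a - sin b) • EuclideanSpace.single 1 1)
  rw [← e, map_smul_eq_mul, map_smul_eq_mul, Real.norm_eq_abs, Real.norm_eq_abs] at h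
  have h1 : |cos a - cos b| ≤ |a - b| := by
    simpa [Real.dist_eq] using Real.lipschitzWith_cos.dist_le_mul a b
  have h2 : |sin a - sin b| ≤ |a - b| := by
    simpa [Real.dist_eq] using Real.lipschitzWith_sin.dist_le_mul a b
  have h3 := apply_nonneg N (EuclideanSpace.single 0 1 : Plane)
  have h4 := apply_nonneg N (EuclideanSpace.single 1 1 : Plane)
  nlinarith

lemma norm_unitCurve_sub_le (hN : IsPlaneNorm N) (a b : ℝ) :
    N (unitCurve N a - unitCurve N b) ≤
      2 * (N (angleVec a))⁻¹ * N (angleVec a - angleVec b) := by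
  have ha := hN.pos (angleVec_ne_zero a)
  have hb := hN.pos (angleVec_ne_zero b)
  have e : unitCurve N a - unitCurve N b = (N (angleVec a))⁻¹ • (angleVec a - angleVec b) +
      ((N (angleVec a))⁻¹ * (N (angleVec b) - N (angleVec a)) * (N (angleVec b))⁻¹) •
        angleVec b := by
    have : (N (angleVec a))⁻¹ * (N (angleVec b) - N (angleVec a)) * (N (angleVec b))⁻¹ =
        (N (angleVec a))⁻¹ - (N (angleVec b))⁻¹ := by field_simp
    rw [this, unitCurve, unitCurve]
    module
  have h1 := map_add_le_add N ((N (angleVec a))⁻¹ • (angleVec a - angleVec b))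
    (((N (angleVec a))⁻¹ * (N (angleVec b) - N (angleVec a)) * (N (angleVec b))⁻¹) •
        angleVec b)
  have h2 : |N (angleVec b) - N (angleVec a)| ≤ N (angleVec a - angleVec b) := by
    rw [map_sub_rev]; exact abs_sub_map_le_sub N _ _
  rw [← e, N.map_smul_nonneg (by positivity), map_smul_eq_mul, Real.norm_eq_abs, abs_mul,
    abs_mul, abs_of_pos (inv_pos.2 ha), abs_of_pos (inv_pos.2 hb), mul_assoc _ _ (N (angleVec b)),
    inv_mul_cancel₀ hb.ne', mul_one] at h1
  have h3 := mul_le_mul_of_nonneg_left h2 (inv_pos.2 ha).le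
  linarith

lemma curveLength_unitCurve_ne_top (hN : IsPlaneNorm N) (s t : ℝ) :
    curveLength N (unitCurve N) s t ≠ ⊤ := by
  rcases lt_or_ge t s with h | h
  · have h0 : curveLength N (unitCurve N) s t = 0 := by
      rw [curveLength, Icc_eq_empty (not_le.2 h)]
      exact eVariationOn.subsingleton (E := SeminormSpace N) _ subsingleton_empty
    rw [h0]
    exact ENNReal.zero_ne_top
  obtain ⟨m, -, hm⟩ := isCompact_Icc.exists_isMinOn (nonempty_Icc.2 h)
    (hN.continuous.comp continuous_angleVec).continuousOn (s := Icc s t)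
  have hmpos := hN.pos (angleVec_ne_zero m)
  obtain ⟨K, hK, hKb⟩ := norm_angleVec_sub_le N
  have hL : LipschitzOnWith (β := SeminormSpace N) (2 * (N (angleVec m))⁻¹ * K).toNNReal
      (unitCurve N) (Icc s t) := by
    refine LipschitzOnWith.of_dist_le_mul fun a ha b _ => ?_
    rw [Real.coe_toNNReal _ (by positivity)]
    refine (norm_unitCurve_sub_le hN a b).trans ?_
    have h1 : N (angleVec m) ≤ N (angleVec a) := hm ha
    have h2 := inv_anti₀ hmpos h1
    rw [mul_assoc _ K, Real.dist_eq]
    have h3 := apply_nonneg N (angleVec a - angleVec b)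
    have h4 := (inv_pos.2 hmpos).le
    exact mul_le_mul (by linarith) (hKb a b) h3 (by linarith)
  have := hL.locallyBoundedVariationOn s t (left_mem_Icc.2 h) (right_mem_Icc.2 h)
  rwa [inter_self] at this

lemma curveLength_le_of_tendsto {γ : ℝ → Plane} (hN : Continuous N) (hγ : Continuous γ)
    {s t : ℕ → ℝ} {a b : ℝ} (hst : ∀ k, s k ≤ t k) (hs : Tendsto s atTop (𝓝 a))
    (ht : Tendsto t atTop (𝓝 b)) {B : ℕ → ℝ≥0∞} {B' : ℝ≥0∞}
    (hB : ∀ k, curveLength N γ (s k) (t k) ≤ B k) (hBt : Tendsto B atTop (𝓝 B')) :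
    curveLength N γ a b ≤ B' := by
  have hab : a ≤ b := le_of_tendsto_of_tendsto' hs ht hst
  have key : ∀ p q : ℝ, p ≤ q →
      curveLength N γ p q = curveLength N (γ ∘ fun r => p + r * (q - p)) 0 1 := by
    intro p q hpq
    rw [curveLength_comp_monotone γ zero_le_one
      (fun x _ y _ hxy => by
        have := mul_le_mul_of_nonneg_right hxy (sub_nonneg.2 hpq)
        simpa using this)
      (by fun_prop)]
    simp
  by_contra hlt
  push Not at hlt
  obtain ⟨v, hv1, hv2⟩ := exists_between hlt
  rw [key a b hab] at hv2
  have hlim : ∀ x ∈ Icc (0 : ℝ) 1, Tendsto (β := SeminormSpace N)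
      (fun k => (γ ∘ fun r => s k + r * (t k - s k)) x) atTop
      (𝓝 ((γ ∘ fun r => a + r * (b - a)) x)) := by
    intro x _
    refine (tendsto_iff_dist_tendsto_zero (α := SeminormSpace N)).2 ?_
    have h1 : Tendsto (fun k => s k + x * (t k - s k)) atTop (𝓝 (a + x * (b - a))) :=
      hs.add (tendsto_const_nhds.mul (ht.sub hs))
    have h2 := (hγ.tendsto _).comp h1
    have h3 := (h2.sub_const (γ (a + x * (b - a))))
    rw [sub_self] at h3
    have h4 := (hN.tendsto _).comp h3
    rw [map_zero] at h4
    exact h4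
  have h1 := eVariationOn.lowerSemicontinuous_aux (E := SeminormSpace N) hlim hv2
  have h2 := hBt.eventually_lt_const hv1
  obtain ⟨k, hk1, hk2⟩ := (h1.and h2).exists
  have := hB k
  rw [key _ _ (hst k)] at this
  exact absurd (hk1.trans_le (this.trans hk2.le)) (lt_irrefl _)

/-- The length of the unit circle between two angles. -/
noncomputable def unitLength (N : Seminorm ℝ Plane) (s t : ℝ) : ℝ :=
  (curveLength N (unitCurve N) s t).toReal

lemma unitLength_add (hN : IsPlaneNorm N) {a b c : ℝ} (hab : a ≤ b) (hbc : b ≤ c) :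
    unitLength N a b + unitLength N b c = unitLength N a c := by
  rw [unitLength, unitLength, unitLength, ← curveLength_add _ hab hbc,
    ENNReal.toReal_add (curveLength_unitCurve_ne_top hN _ _) (curveLength_unitCurve_ne_top hN _ _)]

lemma ofReal_unitLength (hN : IsPlaneNorm N) (s t : ℝ) :
    ENNReal.ofReal (unitLength N s t) = curveLength N (unitCurve N) s t :=
  ENNReal.ofReal_toReal (curveLength_unitCurve_ne_top hN _ _)

lemma unitLength_nonneg (s t : ℝ) : 0 ≤ unitLength N s t := ENNReal.toReal_nonneg

lemma unitLength_self (s : ℝ) : unitLength N s s = 0 := by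
  rw [unitLength, curveLength_eq_zero_of_eq, ENNReal.toReal_zero]

lemma norm_le_unitLength (hN : IsPlaneNorm N) {s t : ℝ} (h : s ≤ t) :
    N (unitCurve N t - unitCurve N s) ≤ unitLength N s t := by
  have := ofReal_le_curveLength (N := N) (unitCurve N) h
  rwa [← ofReal_unitLength hN, ENNReal.ofReal_le_ofReal_iff (unitLength_nonneg _ _)] at this

lemma unitLength_le_of_linear {s t : ℝ} (h : s ≤ t) (u : Plane →ₗ[ℝ] ℝ)
    (hu : ∀ a b, s ≤ a → a ≤ b → b ≤ t →
      N (unitCurve N b - unitCurve N a) ≤ u (unitCurve N b - unitCurve N a)) :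
    unitLength N s t ≤ u (unitCurve N t - unitCurve N s) :=
  ENNReal.toReal_le_of_le_ofReal ((apply_nonneg N _).trans (hu s t le_rfl h le_rfl))
    (curveLength_le_of_linear _ u hu)

lemma unitLength_add_const {r : ℝ} (hr : ∀ a b, N (unitCurve N (b + r) - unitCurve N (a + r)) =
    N (unitCurve N b - unitCurve N a)) {s t : ℝ} (h : s ≤ t) :
    unitLength N (s + r) (t + r) = unitLength N s t := by
  have := curveLength_comp_monotone (N := N) (unitCurve N) (φ := fun x => x + r) h
    (fun x _ y _ hxy => by simpa using hxy) (by fun_prop)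
  rw [unitLength, ← this, unitLength]
  congr 1
  exact curveLength_congr_norm fun a b => hr a b

lemma unitLength_add_pi {s t : ℝ} (h : s ≤ t) :
    unitLength N (s + π) (t + π) = unitLength N s t :=
  unitLength_add_const (fun a b => by
    rw [unitCurve_add_pi, unitCurve_add_pi, neg_sub_neg, map_sub_rev]) h

lemma unitLength_add_int_mul {s t : ℝ} (h : s ≤ t) (k : ℤ) :
    unitLength N (s + k * (2 * π)) (t + k * (2 * π)) = unitLength N s t :=
  unitLength_add_const (fun a b => by
    rw [unitCurve_add_int_mul, unitCurve_add_int_mul]) h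

end curveLength

section arcFun

variable {N : Seminorm ℝ Plane}

/-- An arc of the unit circle, at most half a turn long, has a minimality property expressed by
each of its functionals. -/
lemma IsArcFunctional.le_unitLength (hN : IsPlaneNorm N) {s t : ℝ} {u : Plane →ₗ[ℝ] ℝ}
    (hu : IsArcFunctional N s t u) (hst : s ≤ t) (hts : t ≤ s + π) {a b : ℝ} (hab : a ≤ b)
    (hba : b ≤ a + π) :
    unitLength N s t + u ((unitCurve N b - unitCurve N a) - (unitCurve N t - unitCurve N s)) ≤
      unitLength N a b := by
  wlog ha : a ∈ Ico s (s + 2 * π) generalizing a b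
  · set k : ℤ := -toIcoDiv two_pi_pos s a with hk
    have h1 : a + k * (2 * π) ∈ Ico s (s + 2 * π) := by
      have := toIcoMod_mem_Ico two_pi_pos s a
      rwa [toIcoMod, sub_eq_add_neg, zsmul_eq_mul, ← neg_mul, ← Int.cast_neg] at this
    have := this (a := a + k * (2 * π)) (b := b + k * (2 * π)) (by linarith) (by linarith) h1
    rwa [unitLength_add_int_mul hab, unitCurve_add_int_mul, unitCurve_add_int_mul] at this
  set Ψ : ℝ → ℝ → ℝ := fun x y => unitLength N x y - u (unitCurve N y - unitCurve N x) with hΨ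
  have hadd : ∀ {x y z}, x ≤ y → y ≤ z → Ψ x y + Ψ y z = Ψ x z := by
    intro x y z hxy hyz
    simp only [hΨ, ← unitLength_add hN hxy hyz, map_sub]
    ring
  have hneg : ∀ {x y}, s ≤ x → x ≤ y → y ≤ t → Ψ x y ≤ 0 := fun {x y} hx hxy hy =>
    sub_nonpos.2 (unitLength_le_of_linear hxy u
      fun p q hp hpq hq => hu.le_on p q (hx.trans hp) hpq (hq.trans hy))
  have hpos : ∀ {x y}, t ≤ x → x ≤ y → y ≤ s + 2 * π → 0 ≤ Ψ x y := by
    have h1 : ∀ {x y}, t ≤ x → x ≤ y → y ≤ t + π → 0 ≤ Ψ x y := fun {x y} hx hxy hy =>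
      sub_nonneg.2 ((hu.on_le_first x y hx hxy hy).trans (norm_le_unitLength hN hxy))
    have h2 : ∀ {x y}, s + π ≤ x → x ≤ y → y ≤ s + 2 * π → 0 ≤ Ψ x y := fun {x y} hx hxy hy =>
      sub_nonneg.2 ((hu.on_le_second x y hx hxy hy).trans (norm_le_unitLength hN hxy))
    intro x y hx hxy hy
    rcases le_total y (t + π) with h | h
    · exact h1 hx hxy h
    rcases le_total (s + π) x with h' | h'
    · exact h2 h' hxy hy
    rw [← hadd (h'.trans (by linarith : s + π ≤ t + π)) h]
    exact add_nonneg (h1 hx (by linarith) le_rfl) (h2 (by linarith) h hy)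
  suffices h : Ψ s t ≤ Ψ a b by
    simp only [hΨ] at h
    rw [map_sub u (_ - _)]
    linarith
  have hst0 := hneg le_rfl hst le_rfl
  rcases le_total a t with hat | hat
  · rcases le_total b t with hbt | hbt
    · have h1 := hneg le_rfl ha.1 hat
      have h2 := hneg (ha.1.trans hab) hbt le_rfl
      have h3 := hadd ha.1 hat
      have h4 := hadd hab hbt
      linarith
    · have h1 := hneg le_rfl ha.1 hat
      have h2 := hpos le_rfl hbt (by linarith)
      have h3 := hadd ha.1 hat
      have h4 := hadd hat hbt
      linarith
  · rcases le_total b (s + 2 * π) with hb | hb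
    · linarith [hpos hat hab hb]
    · have h1 := hpos hat ha.2.le le_rfl
      have h2 := hadd ha.2.le hb
      have h3 : Ψ (s + 2 * π) b = Ψ s (b - 2 * π) := by
        have e := unitLength_add_int_mul (N := N) (s := s) (t := b - 2 * π) (by linarith) 1
        simp only [Int.cast_one, one_mul, sub_add_cancel] at e
        have e' := unitCurve_add_two_pi (N := N) (b - 2 * π)
        rw [sub_add_cancel] at e'
        simp only [hΨ, e, unitCurve_add_two_pi, e']
      rcases le_total (b - 2 * π) t with h | h
      · have h4 := hadd (show s ≤ b - 2 * π by linarith) h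
        have h5 := hneg (by linarith) h le_rfl
        linarith
      · have h4 := hadd hst h
        have h5 := hpos le_rfl h (by linarith [ha.2, pi_pos])
        linarith

/-- The arc of the unit circle from `s` to `t` is at most half a turn long and its chord is `d`. -/
structure IsChord (N : Seminorm ℝ Plane) (d : Plane) (s t : ℝ) : Prop where
  le : s ≤ t
  le_add_pi : t ≤ s + π
  eq : unitCurve N t - unitCurve N s = d

lemma IsChord.norm_le_two (hN : IsPlaneNorm N) {d : Plane} {s t : ℝ} (h : IsChord N d s t) :
    N d ≤ 2 := by
  have := map_sub_le_add N (unitCurve N t) (unitCurve N s)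
  rw [h.eq, norm_unitCurve hN, norm_unitCurve hN] at this
  linarith

lemma IsChord.lt_add_pi (hN : IsPlaneNorm N) {d : Plane} {s t : ℝ} (h : IsChord N d s t)
    (hd : N d < 2) : t < s + π := by
  refine lt_of_le_of_ne h.le_add_pi ?_
  rintro rfl
  have := h.eq
  rw [unitCurve_add_pi, show -unitCurve N s - unitCurve N s = (-2 : ℝ) • unitCurve N s by module]
    at this
  rw [← this, map_smul_eq_mul, norm_unitCurve hN] at hd
  norm_num at hd

lemma IsChord.add_int_mul {d : Plane} {s t : ℝ} (h : IsChord N d s t) (k : ℤ) :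
    IsChord N d (s + k * (2 * π)) (t + k * (2 * π)) where
  le := by linarith [h.le]
  le_add_pi := by linarith [h.le_add_pi]
  eq := by rw [unitCurve_add_int_mul, unitCurve_add_int_mul, h.eq]

/-- A long arc may be replaced by a part of the opposite of the complementary arc. -/
lemma isChord_of_pi_lt {s t : ℝ} (h : s + π ≤ t) (h' : t ≤ s + 2 * π) :
    IsChord N (unitCurve N t - unitCurve N s) (t - π) (s + π) where
  le := by linarith
  le_add_pi := by linarith
  eq := by rw [unitCurve_add_pi, unitCurve_sub_pi]; abel

lemma exists_isChord (hN : IsPlaneNorm N) {d : Plane} (hd : N d ≤ 2) :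
    ∃ s t, IsChord N d s t := by
  obtain ⟨θ, -, hθ⟩ := exists_unitCurve hN d 0
  have hc : Continuous fun τ => N (unitCurve N τ + d) :=
    hN.continuous.comp ((continuous_unitCurve hN).add continuous_const)
  have h0 := apply_nonneg N d
  have h1 : 1 ≤ N (unitCurve N θ + d) := by
    rw [hθ, show unitCurve N θ + N d • unitCurve N θ = (1 + N d) • unitCurve N θ by module,
      N.map_smul_nonneg (by linarith), norm_unitCurve hN]
    linarith
  have h2 : N (unitCurve N (θ + π) + d) ≤ 1 := by
    rw [unitCurve_add_pi]
    nth_rw 1 [hθ]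
    rw [show -unitCurve N θ + N d • unitCurve N θ = (N d - 1) • unitCurve N θ by module,
      map_smul_eq_mul, norm_unitCurve hN, mul_one, Real.norm_eq_abs, abs_le]
    constructor <;> linarith
  obtain ⟨τ, -, hτ⟩ : (1 : ℝ) ∈ (fun τ => N (unitCurve N τ + d)) '' univ :=
    isPreconnected_univ.intermediate_value (mem_univ (θ + π)) (mem_univ θ) hc.continuousOn ⟨h2, h1⟩
  obtain ⟨t, ht, hte⟩ := exists_unitCurve hN (unitCurve N τ + d) τ
  rw [show N (unitCurve N τ + d) = 1 from hτ, one_smul] at hte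
  have hd' : unitCurve N t - unitCurve N τ = d := by rw [← hte]; abel
  rcases le_total t (τ + π) with h | h
  · exact ⟨τ, t, ht.1, h, hd'⟩
  · exact ⟨t - π, τ + π, hd' ▸ isChord_of_pi_lt h ht.2.le⟩

/-- Semicontinuity of the length of the arcs with a given chord. -/
lemma exists_isChord_of_tendsto (hN : IsPlaneNorm N) {d : ℕ → Plane} {d' : Plane}
    {s t B : ℕ → ℝ} {B' : ℝ} (hd : Tendsto d atTop (𝓝 d')) (hst : ∀ k, IsChord N (d k) (s k) (t k))
    (hB : ∀ k, unitLength N (s k) (t k) ≤ B k) (hBt : Tendsto B atTop (𝓝 B')) :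
    ∃ a b, IsChord N d' a b ∧ unitLength N a b ≤ B' := by
  wlog hs : ∀ k, s k ∈ Icc 0 (2 * π) generalizing s t
  · set m : ℕ → ℤ := fun k => -toIcoDiv two_pi_pos 0 (s k) with hm
    refine this (s := fun k => s k + m k * (2 * π)) (t := fun k => t k + m k * (2 * π))
      (fun k => (hst k).add_int_mul _)
      (fun k => (unitLength_add_int_mul (hst k).le _).trans_le (hB k)) fun k => ?_
    have := toIcoMod_mem_Ico two_pi_pos 0 (s k)
    rw [toIcoMod, sub_eq_add_neg, zsmul_eq_mul, ← neg_mul, ← Int.cast_neg, zero_add] at this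
    exact Ico_subset_Icc_self this
  have hmem : ∀ k, (s k, t k) ∈ Icc (0 : ℝ) (2 * π) ×ˢ Icc (0 : ℝ) (3 * π) := fun k =>
    ⟨hs k, (hs k).1.trans (hst k).le, (hst k).le_add_pi.trans (by linarith [(hs k).2])⟩
  obtain ⟨⟨a, b⟩, -, φ, hφ, hlim⟩ :=
    (isCompact_Icc.prod isCompact_Icc).tendsto_subseq hmem
  have hla : Tendsto (fun k => s (φ k)) atTop (𝓝 a) := (continuous_fst.tendsto _).comp hlim
  have hlb : Tendsto (fun k => t (φ k)) atTop (𝓝 b) := (continuous_snd.tendsto _).comp hlim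
  have hc := continuous_unitCurve hN
  refine ⟨a, b, ⟨le_of_tendsto_of_tendsto' hla hlb fun k => (hst _).le,
    le_of_tendsto_of_tendsto' hlb (hla.add_const π) fun k => (hst _).le_add_pi, ?_⟩, ?_⟩
  · refine tendsto_nhds_unique (((hc.tendsto b).comp hlb).sub ((hc.tendsto a).comp hla)) ?_
    exact (hd.comp hφ.tendsto_atTop).congr fun k => (hst (φ k)).eq.symm
  · have hB0 : 0 ≤ B' := ge_of_tendsto' hBt fun k => (unitLength_nonneg _ _).trans (hB k)
    refine ENNReal.toReal_le_of_le_ofReal hB0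
      (curveLength_le_of_tendsto hN.continuous hc (fun k => (hst (φ k)).le) hla hlb
        (B := fun k => ENNReal.ofReal (B (φ k))) (fun k => ?_)
        (ENNReal.tendsto_ofReal (hBt.comp hφ.tendsto_atTop)))
    rw [← ofReal_unitLength hN]
    exact ENNReal.ofReal_le_ofReal (hB _)

/-- The smallest length of an arc of the unit circle with chord `d`. -/
noncomputable def arcFun (N : Seminorm ℝ Plane) (d : Plane) : ℝ :=
  sInf {l | ∃ s t, IsChord N d s t ∧ unitLength N s t = l}

lemma arcFun_le {d : Plane} {s t : ℝ} (h : IsChord N d s t) : arcFun N d ≤ unitLength N s t :=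
  csInf_le ⟨0, by rintro _ ⟨a, b, -, rfl⟩; exact unitLength_nonneg _ _⟩ ⟨s, t, h, rfl⟩

lemma exists_unitLength_eq_arcFun (hN : IsPlaneNorm N) {d : Plane} (hd : N d ≤ 2) :
    ∃ s t, IsChord N d s t ∧ unitLength N s t = arcFun N d := by
  obtain ⟨s₀, t₀, h₀⟩ := exists_isChord hN hd
  have hex : ∀ k : ℕ, ∃ p : ℝ × ℝ, IsChord N d p.1 p.2 ∧
      unitLength N p.1 p.2 ≤ arcFun N d + 1 / ((k : ℝ) + 1) := by
    intro k
    have hk : arcFun N d < arcFun N d + 1 / ((k : ℝ) + 1) :=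
      lt_add_of_pos_right _ Nat.one_div_pos_of_nat
    have hne : {l | ∃ s t, IsChord N d s t ∧ unitLength N s t = l}.Nonempty :=
      ⟨_, s₀, t₀, h₀, rfl⟩
    obtain ⟨_, ⟨s, t, h, rfl⟩, hlt⟩ := exists_lt_of_csInf_lt hne hk
    exact ⟨(s, t), h, hlt.le⟩
  choose p hp hpB using hex
  have hlim : Tendsto (fun k : ℕ => arcFun N d + 1 / ((k : ℝ) + 1)) atTop (𝓝 (arcFun N d)) := by
    simpa using tendsto_const_nhds.add (tendsto_one_div_add_atTop_nhds_zero_nat (𝕜 := ℝ))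
  obtain ⟨s, t, h, hle⟩ := exists_isChord_of_tendsto hN tendsto_const_nhds hp hpB hlim
  exact ⟨s, t, h, le_antisymm hle (arcFun_le h)⟩

lemma arcFun_nonneg (d : Plane) : 0 ≤ arcFun N d :=
  Real.sInf_nonneg (by rintro _ ⟨s, t, -, rfl⟩; exact unitLength_nonneg _ _)

lemma norm_le_arcFun (hN : IsPlaneNorm N) {d : Plane} (hd : N d ≤ 2) : N d ≤ arcFun N d := by
  obtain ⟨s, t, h, he⟩ := exists_unitLength_eq_arcFun hN hd
  rw [← he]
  nth_rw 1 [← h.eq]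
  exact norm_le_unitLength hN h.le

lemma arcFun_zero : arcFun N 0 = 0 :=
  le_antisymm ((arcFun_le (s := 0) (t := 0) ⟨le_rfl, by simpa using pi_pos.le, sub_self _⟩).trans_eq
    (unitLength_self 0)) (arcFun_nonneg 0)

lemma IsArcFunctional.le_arcFun (hN : IsPlaneNorm N) {s t : ℝ} {u : Plane →ₗ[ℝ] ℝ}
    (hu : IsArcFunctional N s t u) (hst : s ≤ t) (hts : t ≤ s + π) {d : Plane} (hd : N d ≤ 2) :
    unitLength N s t + u (d - (unitCurve N t - unitCurve N s)) ≤ arcFun N d := by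
  obtain ⟨a, b, h, he⟩ := exists_unitLength_eq_arcFun hN hd
  have := hu.le_unitLength hN hst hts h.le h.le_add_pi
  rwa [he, h.eq] at this

lemma IsChord.exists_isArcFunctional (hN : IsPlaneNorm N) {d : Plane} {s t : ℝ}
    (h : IsChord N d s t) (hd : N d < 2) : ∃ u, IsArcFunctional N s t u := by
  obtain ⟨S, hS⟩ := exists_isSupport hN s
  rcases h.le.eq_or_lt with rfl | hlt
  · obtain ⟨u, hu, -⟩ := hS.isArcFunctional_of_eq hN hS (by linarith [pi_pos])
    exact ⟨u, hu⟩
  obtain ⟨T, hT⟩ := exists_isSupport hN t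
  rcases (hS.area_nonneg hN hT hlt (h.lt_add_pi hN hd)).lt_or_eq with hpos | hzero
  · exact ⟨_, hS.isArcFunctional_normInterp hN hT h.le_add_pi hpos⟩
  · obtain rfl := hS.eq_of_area_eq_zero hN hT hzero.symm (by rwa [h.eq])
    obtain ⟨u, hu, -⟩ := hS.isArcFunctional_of_eq hN hT h.le_add_pi
    exact ⟨u, hu⟩

/-- `arcFun` has a subgradient at every vector of norm less than two. -/
lemma exists_subgradient_arcFun (hN : IsPlaneNorm N) {d : Plane} (hd : N d < 2) :
    ∃ u : Plane →ₗ[ℝ] ℝ, ∀ e, N e ≤ 2 → arcFun N d + u (e - d) ≤ arcFun N e := by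
  obtain ⟨s, t, h, he⟩ := exists_unitLength_eq_arcFun hN hd.le
  obtain ⟨u, hu⟩ := h.exists_isArcFunctional hN hd
  refine ⟨u, fun e hE => ?_⟩
  have := hu.le_arcFun hN h.le h.le_add_pi hE
  rwa [he, h.eq] at this

/-- Radial lower semicontinuity of `arcFun`. -/
lemma arcFun_le_of_forall_smul (hN : IsPlaneNorm N) {d : Plane} (hd : N d ≤ 2) {B : ℝ}
    (h : ∀ r : ℝ, 0 ≤ r → r < 1 → arcFun N (r • d) ≤ B) : arcFun N d ≤ B := by
  set r : ℕ → ℝ := fun k => 1 - 1 / ((k : ℝ) + 1) with hr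
  have hr0 : ∀ k, 0 ≤ r k := fun k => sub_nonneg.2 (by
    rw [div_le_one (by positivity)]; linarith [Nat.cast_nonneg (α := ℝ) k])
  have hr1 : ∀ k, r k < 1 := fun k => sub_lt_self _ Nat.one_div_pos_of_nat
  have hlim : Tendsto r atTop (𝓝 1) := by
    have := (tendsto_one_div_add_atTop_nhds_zero_nat (𝕜 := ℝ)).const_sub 1
    rwa [sub_zero] at this
  have hex : ∀ k, ∃ p : ℝ × ℝ, IsChord N (r k • d) p.1 p.2 ∧ unitLength N p.1 p.2 ≤ B := by
    intro k
    obtain ⟨s, t, hst, he⟩ := exists_unitLength_eq_arcFun hN (d := r k • d) (by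
      rw [N.map_smul_nonneg (hr0 k)]
      nlinarith [hr0 k, hr1 k, apply_nonneg N d])
    exact ⟨(s, t), hst, he.trans_le (h _ (hr0 k) (hr1 k))⟩
  choose p hp hpB using hex
  obtain ⟨s, t, hst, hle⟩ := exists_isChord_of_tendsto hN
    (by simpa using hlim.smul_const d) hp hpB tendsto_const_nhds
  exact (arcFun_le hst).trans hle

/-- Convexity of `arcFun`, for convex combinations with the origin. -/
lemma arcFun_add_le (hN : IsPlaneNorm N) {d e : Plane} (hd : N d ≤ 2) (he : N e ≤ 2) {q r : ℝ}
    (hq : 0 ≤ q) (hr : 0 ≤ r) (hqr : q + r ≤ 1) :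
    arcFun N (q • d + r • e) ≤ q * arcFun N d + r * arcFun N e := by
  have hnorm : N (q • d + r • e) ≤ 2 := by
    have := map_add_le_add N (q • d) (r • e)
    rw [N.map_smul_nonneg hq, N.map_smul_nonneg hr] at this
    nlinarith
  refine arcFun_le_of_forall_smul hN hnorm fun l hl0 hl1 => ?_
  obtain ⟨u, hu⟩ := exists_subgradient_arcFun hN (d := l • (q • d + r • e)) (by
    rw [N.map_smul_nonneg hl0]
    nlinarith [apply_nonneg N (q • d + r • e)])
  have h1 := hu d hd
  have h2 := hu e he
  have h3 := hu 0 (by rw [map_zero]; norm_num)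
  rw [arcFun_zero] at h3
  simp only [map_sub, map_smul, map_add, map_zero, smul_eq_mul] at h1 h2 h3
  have k1 := mul_le_mul_of_nonneg_left h1 (mul_nonneg hl0 hq)
  have k2 := mul_le_mul_of_nonneg_left h2 (mul_nonneg hl0 hr)
  have hw : 0 ≤ 1 - l * q - l * r := by nlinarith
  have k3 := mul_le_mul_of_nonneg_left h3 hw
  have m1 := mul_nonneg hq (arcFun_nonneg (N := N) d)
  have m2 := mul_nonneg hr (arcFun_nonneg (N := N) e)
  have k4 : arcFun N (l • (q • d + r • e)) ≤ l * (q * arcFun N d + r * arcFun N e) := by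
    linarith
  nlinarith

lemma arcFun_smul_le (hN : IsPlaneNorm N) {d : Plane} (hd : N d ≤ 2) {r : ℝ} (hr : 0 ≤ r)
    (hr1 : r ≤ 1) : arcFun N (r • d) ≤ r * arcFun N d := by
  have := arcFun_add_le hN hd hd hr le_rfl (by linarith : r + 0 ≤ 1)
  simpa using this

end arcFun

section outside

variable {N : Seminorm ℝ Plane}

lemma unitLength_le_arcFun_add_of_isSupport (hN : IsPlaneNorm N) {s τ t : ℝ} {S V T : Plane}
    (hS : IsSupport N s S) (hV : IsSupport N τ V) (hT : IsSupport N t T) (hsτ : s ≤ τ)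
    (hτt : τ ≤ t) (hts : t ≤ s + π) (hSV : 0 < area S V) (hVT : 0 < area V T)
    (hST : 0 < area S T) {x y z : Plane} (hxz : IsChord N (z - x) s t) (hx : area x S ≤ 1)
    (hz : area z T ≤ 1) (hy : 1 ≤ area y V) (hyx : N (y - x) ≤ 2) (hzy : N (z - y) ≤ 2) :
    unitLength N s t ≤ arcFun N (y - x) + arcFun N (z - y) := by
  have h1 := (hS.isArcFunctional_normInterp hN hV (by linarith) hSV).le_arcFun hN hsτ
    (by linarith) hyx
  have h2 := (hV.isArcFunctional_normInterp hN hT (by linarith) hVT).le_arcFun hN hτt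
    (by linarith) hzy
  have hadd := unitLength_add hN hsτ hτt
  set w := y - x - (unitCurve N τ - unitCurve N s) with hw
  have he := hxz.eq
  have hw' : z - y - (unitCurve N t - unitCurve N τ) = -w := by
    have : z = x + (unitCurve N t - unitCurve N s) := by rw [he]; abel
    rw [hw, this]; abel
  rw [hw', map_neg] at h2
  have hxs : area (x - unitCurve N s) V ≤ 0 := by
    have e := area_smul_eq S T V
    have e1 : area (x - unitCurve N s) (area S T • V) =
        area V T * area (x - unitCurve N s) S + area S V * area (x - unitCurve N s) T := by
      rw [e, area_add_right, area_smul_right, area_smul_right]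
    have k1 : area (x - unitCurve N s) S ≤ 0 := by
      rw [area_sub_left, hS.eq_one]; linarith
    have k2 : area (x - unitCurve N s) T ≤ 0 := by
      rw [show x - unitCurve N s = z - unitCurve N t by
        rw [sub_eq_sub_iff_sub_eq_sub, ← neg_sub z x, ← he, neg_sub], area_sub_left, hT.eq_one]
      linarith
    rw [area_smul_right] at e1
    by_contra hneg
    push Not at hneg
    nlinarith
  have hwV : 0 ≤ area w V := by
    rw [area_sub_left] at hxs
    rw [hw, area_sub_left, area_sub_left, area_sub_left, hV.eq_one]
    linarith
  have key : normInterp N V T w ≤ normInterp N S V w := by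
    have hSle : normInterp N V T S ≤ N S := normInterp_le hVT (Or.inl hSV.le)
    have e1 : normInterp N S V S = N S := by
      rw [normInterp_apply, area_self]; field_simp; ring
    have e2 : normInterp N S V V = N V := by
      rw [normInterp_apply, area_self, area_swap V S]; field_simp; ring
    have e3 : normInterp N V T V = N V := by
      rw [normInterp_apply, area_self]; field_simp; ring
    have e := area_smul_eq S V w
    have k1 := congrArg (normInterp N S V) e
    have k2 := congrArg (normInterp N V T) e
    simp only [map_add, map_smul, smul_eq_mul, e1, e2, e3] at k1 k2
    by_contra hneg
    push Not at hneg
    nlinarith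
  linarith

lemma unitLength_le_arcFun_add_of_area_pos (hN : IsPlaneNorm N) {s t : ℝ} {S V T : Plane}
    (hS : IsSupport N s S) (hT : IsSupport N t T) (hst : s < t) (hts : t < s + π)
    (hSV : 0 < area S V) (hVT : 0 < area V T) (hST : 0 < area S T) {x y z : Plane}
    (hxz : IsChord N (z - x) s t) (hx : area x S ≤ 1) (hz : area z T ≤ 1)
    (hV : ∀ w, area w V ≤ N w) (hyV : area y V = N y) (hy : 1 ≤ N y) (hyx : N (y - x) ≤ 2)
    (hzy : N (z - y) ≤ 2) : unitLength N s t ≤ arcFun N (y - x) + arcFun N (z - y) := by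
  suffices h : ∃ τ, s ≤ τ ∧ τ ≤ t ∧ IsSupport N τ V by
    obtain ⟨τ, h1, h2, hτ⟩ := h
    exact unitLength_le_arcFun_add_of_isSupport hN hS hτ hT h1 h2 hts.le hSV hVT hST hxz hx hz
      (hyV ▸ hy) hyx hzy
  obtain ⟨φ, hφ, hyφ⟩ := exists_unitCurve hN y s
  have hφV : IsSupport N φ V := by
    refine ⟨?_, hV⟩
    have : N y * area (unitCurve N φ) V = N y := by rw [← area_smul_left, ← hyφ, hyV]
    exact mul_left_cancel₀ (by linarith : N y ≠ 0) (by rw [this, mul_one])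
  have hcomb : ∀ w, area S T * area w V = area V T * area w S + area S V * area w T := by
    intro w
    rw [← area_smul_right, area_smul_eq S T V, area_add_right, area_smul_right, area_smul_right]
  have hmove : ∀ r, area (unitCurve N φ) S ≤ area (unitCurve N r) S →
      area (unitCurve N φ) T ≤ area (unitCurve N r) T → IsSupport N r V := by
    intro r h1 h2
    refine ⟨le_antisymm (hφV.le_one hN r) ?_, hV⟩
    have e1 := hcomb (unitCurve N φ)
    have e2 := hcomb (unitCurve N r)
    rw [hφV.eq_one] at e1
    by_contra hneg
    push Not at hneg
    nlinarith
  rcases le_or_gt φ t with h1 | h1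
  · exact ⟨φ, hφ.1, h1, hφV⟩
  rcases le_or_gt φ (s + π) with h2 | h2
  · exact ⟨t, hst.le, le_rfl, hmove t (hS.antitoneOn hN hst.le h1.le h2)
      (hT.antitoneOn hN le_rfl h1.le (by linarith))⟩
  rcases le_or_gt (t + π) φ with h3 | h3
  · refine ⟨s, le_rfl, hst.le, hmove s ?_ ?_⟩ <;> rw [← unitCurve_add_two_pi s]
    · exact hS.add_two_pi.monotoneOn hN (by linarith) hφ.2.le le_rfl
    · exact hT.add_two_pi.monotoneOn hN (by linarith) hφ.2.le (by linarith)
  · have := hS.area_nonneg hN hφV.sub_pi (by linarith) (by linarith)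
    rw [area_neg_right] at this
    linarith

lemma arcFun_le_add_of_lt_two (hN : IsPlaneNorm N) {x y z : Plane} (hx : N x ≤ 1) (hz : N z ≤ 1)
    (hy : 1 ≤ N y) (hyx : N (y - x) ≤ 2) (hzy : N (z - y) ≤ 2) (hzx : N (z - x) < 2) :
    arcFun N (z - x) ≤ arcFun N (y - x) + arcFun N (z - y) := by
  obtain ⟨s, t, h, he⟩ := exists_unitLength_eq_arcFun hN hzx.le
  rw [← he]
  have hN1 := norm_le_arcFun hN hyx
  have hN2 := norm_le_arcFun hN hzy
  rcases h.le.eq_or_lt with rfl | hst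
  · rw [unitLength_self]
    exact add_nonneg (arcFun_nonneg _) (arcFun_nonneg _)
  have hts := h.lt_add_pi hN hzx
  obtain ⟨S, hS⟩ := exists_isSupport hN s
  obtain ⟨T, hT⟩ := exists_isSupport hN t
  rcases (hS.area_nonneg hN hT hst hts).eq_or_lt with hzero | hpos
  · obtain rfl := hS.eq_of_area_eq_zero hN hT hzero.symm (by rwa [h.eq])
    obtain ⟨u, hu, huN⟩ := hS.isArcFunctional_of_eq hN hT h.le_add_pi
    have h1 := unitLength_le_of_linear h.le u hu.le_on
    have h2 := huN (unitCurve N t - unitCurve N s)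
    rw [h.eq] at h1 h2
    have h3 := map_add_le_add N (z - y) (y - x)
    rw [sub_add_sub_cancel] at h3
    linarith
  have hu := hS.isArcFunctional_normInterp hN hT h.le_add_pi hpos
  by_cases h1 : 0 ≤ area (y - x) S ∨ area (y - x) T ≤ 0
  · have k1 := normInterp_le (N := N) hpos h1
    have k2 := hu.le_arcFun hN h.le h.le_add_pi hzy
    rw [h.eq, show z - y - (z - x) = -(y - x) by abel, map_neg] at k2
    linarith
  by_cases h2 : 0 ≤ area (z - y) S ∨ area (z - y) T ≤ 0
  · have k1 := normInterp_le (N := N) hpos h2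
    have k2 := hu.le_arcFun hN h.le h.le_add_pi hyx
    rw [h.eq, show y - x - (z - x) = -(z - y) by abel, map_neg] at k2
    linarith
  push Not at h1 h2
  obtain ⟨V, hyV, hV⟩ := exists_area_eq N y
  have hxV := hV x
  have hzV := hV z
  have hcomb : ∀ w, area S T * area w V = area V T * area w S + area S V * area w T := by
    intro w
    rw [← area_smul_right, area_smul_eq S T V, area_add_right, area_smul_right, area_smul_right]
  have e1 := hcomb (y - x)
  have e2 := hcomb (z - y)
  have p1 : 0 ≤ area S T * area (y - x) V :=
    mul_nonneg hpos.le (by rw [area_sub_left]; linarith)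
  have p2 : area S T * area (z - y) V ≤ 0 :=
    mul_nonpos_of_nonneg_of_nonpos hpos.le (by rw [area_sub_left]; linarith)
  rcases lt_trichotomy (area V T) 0 with hp | hp | hp
  · have hq : area S V < 0 := by
      by_contra hq
      push Not at hq
      have := mul_nonneg hq h2.2.le
      have := mul_pos_of_neg_of_neg hp h2.1
      linarith
    have := unitLength_le_arcFun_add_of_area_pos hN (V := -V) (x := -z) (y := -y) (z := -x) hS hT
      hst hts (by rw [area_neg_right]; linarith) (by rw [area_neg_left]; linarith) hpos
      (by rwa [neg_sub_neg]) (by rw [area_neg_left]; linarith [hS.neg_le z])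
      (by rw [area_neg_left]; linarith [hT.neg_le x])
      (fun w => by
        have := hV (-w)
        rwa [map_neg_eq_map, area_neg_left, ← area_neg_right] at this)
      (by rw [area_neg_left, area_neg_right, neg_neg, map_neg_eq_map, hyV])
      (by rwa [map_neg_eq_map]) (by rwa [neg_sub_neg]) (by rwa [neg_sub_neg])
    rw [neg_sub_neg, neg_sub_neg] at this
    linarith
  · exfalso
    rw [hp] at e1 e2
    have k1 : 0 ≤ area S V := by
      by_contra hq
      push Not at hq
      have := mul_neg_of_neg_of_pos hq h1.2
      linarith
    have k2 : area S V ≤ 0 := by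
      by_contra hq
      push Not at hq
      have := mul_pos hq h2.2
      linarith
    have k3 := hcomb y
    rw [hp, le_antisymm k2 k1, hyV] at k3
    have : 0 < area S T * N y := mul_pos hpos (by linarith)
    linarith
  · have hq : 0 < area S V := by
      by_contra hq
      push Not at hq
      have := mul_nonpos_of_nonpos_of_nonneg hq h1.2.le
      have := mul_neg_of_pos_of_neg hp h1.1
      linarith
    exact unitLength_le_arcFun_add_of_area_pos hN hS hT hst hts hq hp hpos h
      ((hS.le x).trans hx) ((hT.le z).trans hz) hV hyV hy hyx hzy

/-- The triangle inequality for `arcFun` if some unit disk contains `x` and `z`, but does not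
contain `y` in its interior. -/
theorem arcFun_le_add (hN : IsPlaneNorm N) {x y z v : Plane} (hx : N (x - v) ≤ 1)
    (hz : N (z - v) ≤ 1) (hy : 1 ≤ N (y - v)) (hyx : N (y - x) ≤ 2) (hzy : N (z - y) ≤ 2) :
    arcFun N (z - x) ≤ arcFun N (y - x) + arcFun N (z - y) := by
  have hzx : N (z - x) ≤ 2 := by
    have := map_sub_le_add N (z - v) (x - v)
    rw [sub_sub_sub_cancel_right] at this
    linarith
  refine arcFun_le_of_forall_smul hN hzx fun r hr0 hr1 => ?_
  set ρ := N (y - v) with hρ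
  have hρ0 : 0 < ρ := by linarith
  set k := (1 - r) / ρ with hk
  have hk0 : 0 ≤ k := div_nonneg (by linarith) hρ0.le
  have hkρ : k * ρ = 1 - r := div_mul_cancel₀ _ hρ0.ne'
  have hball : ∀ p, N (p - v) ≤ 1 → N (r • (p - v) + k • (y - v)) ≤ 1 := by
    intro p hp
    have := map_add_le_add N (r • (p - v)) (k • (y - v))
    rw [N.map_smul_nonneg hr0, N.map_smul_nonneg hk0, ← hρ, hkρ] at this
    nlinarith
  have main := arcFun_le_add_of_lt_two hN (x := r • (x - v) + k • (y - v))
    (y := (r + k) • (y - v)) (z := r • (z - v) + k • (y - v)) (hball x hx) (hball z hz)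
    (by
      rw [N.map_smul_nonneg (by linarith), ← hρ]
      nlinarith)
    (by
      rw [show (r + k) • (y - v) - (r • (x - v) + k • (y - v)) = r • (y - x) by module,
        N.map_smul_nonneg hr0]
      nlinarith [apply_nonneg N (y - x)])
    (by
      rw [show r • (z - v) + k • (y - v) - (r + k) • (y - v) = r • (z - y) by module,
        N.map_smul_nonneg hr0]
      nlinarith [apply_nonneg N (z - y)])
    (by
      rw [show r • (z - v) + k • (y - v) - (r • (x - v) + k • (y - v)) = r • (z - x) by module,
        N.map_smul_nonneg hr0]
      nlinarith [apply_nonneg N (z - x)])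
  rw [show (r + k) • (y - v) - (r • (x - v) + k • (y - v)) = r • (y - x) by module,
    show r • (z - v) + k • (y - v) - (r + k) • (y - v) = r • (z - y) by module,
    show r • (z - v) + k • (y - v) - (r • (x - v) + k • (y - v)) = r • (z - x) by module] at main
  have h1 := arcFun_smul_le hN hyx hr0 hr1.le
  have h2 := arcFun_smul_le hN hzy hr0 hr1.le
  have h3 := arcFun_nonneg (N := N) (y - x)
  have h4 := arcFun_nonneg (N := N) (z - y)
  nlinarith

end outside

section inside

variable {N : Seminorm ℝ Plane}

lemma arcFun_add_le_of_combination (hN : IsPlaneNorm N) {s t θ : ℝ} {d Y : Plane}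
    (h : IsChord N d s t) (hmin : unitLength N s t = arcFun N d) (hsθ : s ≤ θ) (hθt : θ ≤ t)
    {p q r : ℝ} (hp : 0 ≤ p) (hq : 0 ≤ q) (hr : 0 ≤ r) (hpqr : p + q + r = 1)
    (hY : Y = p • unitCurve N s + q • unitCurve N t + r • unitCurve N θ) :
    arcFun N (Y - unitCurve N s) + arcFun N (unitCurve N t - Y) ≤ arcFun N d := by
  have hd := h.norm_le_two hN
  have c1 : IsChord N (unitCurve N θ - unitCurve N s) s θ :=
    ⟨hsθ, hθt.trans h.le_add_pi, rfl⟩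
  have c2 : IsChord N (unitCurve N t - unitCurve N θ) θ t :=
    ⟨hθt, h.le_add_pi.trans (by linarith), rfl⟩
  have e1 : Y - unitCurve N s = q • d + r • (unitCurve N θ - unitCurve N s) := by
    rw [hY, ← h.eq, show p = 1 - q - r by linarith]; module
  have e2 : unitCurve N t - Y = p • d + r • (unitCurve N t - unitCurve N θ) := by
    rw [hY, ← h.eq, show q = 1 - p - r by linarith]; module
  have k1 := arcFun_add_le hN hd (c1.norm_le_two hN) hq hr (by linarith)
  have k2 := arcFun_add_le hN hd (c2.norm_le_two hN) hp hr (by linarith)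
  rw [← e1] at k1
  rw [← e2] at k2
  have l1 := mul_le_mul_of_nonneg_left (arcFun_le c1) hr
  have l2 := mul_le_mul_of_nonneg_left (arcFun_le c2) hr
  have hadd := unitLength_add hN hsθ hθt
  rw [hmin] at hadd
  have e3 : arcFun N d = q * arcFun N d + p * arcFun N d +
      r * (unitLength N s θ + unitLength N θ t) := by
    rw [hadd, ← add_mul, ← add_mul, show q + p + r = 1 by linarith, one_mul]
  linarith

/-- Points of the unit disk beyond the chord from `s` to `t` are convex combinations of the
endpoints of the chord and of a further point of the arc. -/
lemma exists_combination (hN : IsPlaneNorm N) {s t : ℝ} {d Y : Plane} (h : IsChord N d s t)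
    (hst : s < t) (hY : N Y ≤ 1) (hside : area d (Y - unitCurve N s) < 0) :
    ∃ θ p q r : ℝ, s ≤ θ ∧ θ ≤ t ∧ 0 ≤ p ∧ 0 ≤ q ∧ 0 ≤ r ∧ p + q + r = 1 ∧
      Y = p • unitCurve N s + q • unitCurve N t + r • unitCurve N θ := by
  obtain ⟨θ, hθ, hYθ⟩ := exists_unitCurve hN Y s
  set ρ := N Y with hρ
  have hρ0 : 0 ≤ ρ := apply_nonneg N Y
  have hd := h.eq
  rcases h.le_add_pi.eq_or_lt with rfl | hts
  · rw [unitCurve_add_pi] at hd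
    have hpos : 0 < area (unitCurve N s) (unitCurve N θ) := by
      rw [← hd, hYθ, show -unitCurve N s - unitCurve N s = (-2 : ℝ) • unitCurve N s by module,
        area_smul_left, area_sub_right, area_self, area_smul_right] at hside
      by_contra hneg
      push Not at hneg
      have := mul_nonpos_of_nonneg_of_nonpos hρ0 hneg
      linarith
    refine ⟨θ, (1 - ρ) / 2, (1 - ρ) / 2, ρ, hθ.1, ?_, by linarith, by linarith, hρ0, by ring, ?_⟩
    · by_contra hlt
      push Not at hlt
      exact absurd hpos (not_lt.2 (area_unitCurve_nonpos s θ hlt.le hθ.2.le))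
    · rw [unitCurve_add_pi]
      nth_rw 1 [hYθ]
      module
  have hD := area_unitCurve_pos hN s t hst hts
  set a := unitCurve N s
  set b := unitCurve N t
  have na : N a = 1 := norm_unitCurve hN s
  have nb : N b = 1 := norm_unitCurve hN t
  have hYab := eq_of_area_ne_zero (w := Y) hD.ne'
  set α := area Y b / area a b with hα
  set β := area a Y / area a b with hβ
  have hαβ : 1 < α + β := by
    rw [← hd, area_sub_right, area_sub_left, area_sub_left, area_self, area_swap b a,
      area_swap b Y] at hside
    rw [hα, hβ, ← add_div, lt_div_iff₀ hD]
    linarith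
  have hα0 : 0 ≤ α := by
    by_contra hneg
    push Not at hneg
    have := map_add_le_add N Y ((-α) • a)
    rw [show Y + (-α) • a = β • b by rw [hYab]; module, N.map_smul_nonneg (by linarith),
      N.map_smul_nonneg (by linarith), na, nb] at this
    linarith
  have hβ0 : 0 ≤ β := by
    by_contra hneg
    push Not at hneg
    have := map_add_le_add N Y ((-β) • b)
    rw [show Y + (-β) • b = α • a by rw [hYab]; module, N.map_smul_nonneg (by linarith),
      N.map_smul_nonneg (by linarith), na, nb] at this
    linarith
  have hρpos : 0 < ρ := by
    refine lt_of_le_of_ne hρ0 fun h0 => ?_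
    have hY0 : Y = 0 := by rw [hYθ, ← h0, zero_smul]
    rw [hα, hβ, hY0, area_zero_left, area_swap a 0, area_zero_left] at hαβ
    norm_num at hαβ
  have hpos1 : 0 ≤ area a (unitCurve N θ) := by
    have : 0 ≤ area a Y := by
      have := mul_nonneg hβ0 hD.le; rwa [hβ, div_mul_cancel₀ _ hD.ne'] at this
    rw [hYθ, area_smul_right] at this
    exact nonneg_of_mul_nonneg_right this hρpos
  have hpos2 : 0 ≤ area (unitCurve N θ) b := by
    have : 0 ≤ area Y b := by
      have := mul_nonneg hα0 hD.le; rwa [hα, div_mul_cancel₀ _ hD.ne'] at this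
    rw [hYθ, area_smul_left] at this
    exact nonneg_of_mul_nonneg_right this hρpos
  have hθt : θ ≤ t := by
    by_contra hlt
    push Not at hlt
    rcases le_or_gt θ (s + π) with h1 | h1
    · have := area_unitCurve_pos hN t θ hlt (by linarith)
      rw [area_swap] at this
      linarith
    · have := area_unitCurve_neg hN s θ h1 hθ.2
      linarith
  obtain ⟨α', β', hα', hβ', h1, -, hc⟩ := exists_unitCurve_eq hN hθ.1 hθt hts hst
  set κ := α' + β' with hκ
  have hκρ : 1 < ρ * κ := by
    have e : α + β = ρ * κ := by
      have e1 : area Y b = ρ * (α' * area a b) := by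
        rw [hYθ, hc, area_smul_left, area_add_left, area_smul_left, area_smul_left, area_self]
        ring
      have e2 : area a Y = ρ * (β' * area a b) := by
        rw [hYθ, hc, area_smul_right, area_add_right, area_smul_right, area_smul_right, area_self]
        ring
      rw [hα, hβ, e1, e2, hκ]
      field_simp
    linarith
  have hκ1 : 1 < κ := by nlinarith
  have hκ0 : κ - 1 ≠ 0 := by linarith
  refine ⟨θ, (1 - ρ) / (κ - 1) * α', (1 - ρ) / (κ - 1) * β', (ρ * κ - 1) / (κ - 1), hθ.1, hθt,
    mul_nonneg (div_nonneg (by linarith) (by linarith)) hα',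
    mul_nonneg (div_nonneg (by linarith) (by linarith)) hβ',
    div_nonneg (by linarith) (by linarith), ?_, ?_⟩
  · rw [← mul_add, ← hκ, div_mul_eq_mul_div, ← add_div, div_eq_one_iff_eq hκ0]; ring
  · rw [mul_smul, mul_smul, ← smul_add, ← hc, ← add_smul, ← add_div,
      show 1 - ρ + (ρ * κ - 1) = ρ * (κ - 1) by ring, mul_div_cancel_right₀ _ hκ0]
    exact hYθ

/-- On the line through `x` and `z`, the intersection of the unit disks containing `x` and `z`
does not extend beyond `z`. -/
lemma le_one_of_forall_norm_le (hN : IsPlaneNorm N) {x d : Plane} {κ : ℝ} (hd : N d ≤ 2)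
    (hd0 : d ≠ 0)
    (h : ∀ v, N (x - v) ≤ 1 → N (x + d - v) ≤ 1 → N (x + κ • d - v) ≤ 1) : κ ≤ 1 := by
  by_contra hκ
  push Not at hκ
  have hdpos := hN.pos hd0
  set ρ := (N d)⁻¹ with hρ
  have hρd : ρ * N d = 1 := inv_mul_cancel₀ hdpos.ne'
  have hρ1 : 1 / 2 ≤ ρ := by nlinarith
  have hN1 : ∀ k : ℝ, |k| ≤ ρ → N (k • d) ≤ 1 := by
    intro k hk
    rw [map_smul_eq_mul, Real.norm_eq_abs]
    nlinarith
  have h1 := h (x + (1 - ρ) • d) (by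
      rw [show x - (x + (1 - ρ) • d) = (ρ - 1) • d by module]
      exact hN1 _ (abs_le.2 ⟨by linarith, by linarith⟩))
    (by
      rw [show x + d - (x + (1 - ρ) • d) = ρ • d by module]
      exact hN1 _ (abs_of_pos (by linarith)).le)
  rw [show x + κ • d - (x + (1 - ρ) • d) = (κ - 1 + ρ) • d by module,
    N.map_smul_nonneg (by linarith)] at h1
  nlinarith

/-- The reverse triangle inequality for `arcFun` in the intersection of the unit disks that
contain `x` and `z`. -/
theorem arcFun_add_le_of_forall (hN : IsPlaneNorm N) {x y z : Plane} (hzx : N (z - x) ≤ 2)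
    (h : ∀ v, N (x - v) ≤ 1 → N (z - v) ≤ 1 → N (y - v) ≤ 1) :
    arcFun N (y - x) + arcFun N (z - y) ≤ arcFun N (z - x) := by
  obtain ⟨s, t, hst, hmin⟩ := exists_unitLength_eq_arcFun hN hzx
  have hd := hst.eq
  rcases eq_or_ne (z - x) 0 with h0 | h0
  · have hz : z = x := sub_eq_zero.1 h0
    subst hz
    have hyz : y = z := by
      by_contra hne
      have hpos := hN.pos (sub_ne_zero.2 hne)
      have hzv : N (z - (z - (N (y - z))⁻¹ • (y - z))) ≤ 1 := by
        rw [sub_sub_cancel, N.map_smul_nonneg (by positivity), inv_mul_cancel₀ hpos.ne']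
      have := h _ hzv hzv
      rw [show y - (z - (N (y - z))⁻¹ • (y - z)) = (1 + (N (y - z))⁻¹) • (y - z) by module,
        N.map_smul_nonneg (by positivity), add_mul, inv_mul_cancel₀ hpos.ne'] at this
      linarith
    rw [hyz, sub_self, arcFun_zero, add_zero]
  have hlt : s < t := lt_of_le_of_ne hst.le fun he => h0 (by rw [← hd, he, sub_self])
  have ns := norm_unitCurve hN s
  have nt := norm_unitCurve hN t
  have hz : z = x + (unitCurve N t - unitCurve N s) := by rw [hd]; abel
  have hY := h (x - unitCurve N s) (by rw [sub_sub_cancel, ns])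
    (by rw [hz, show x + (unitCurve N t - unitCurve N s) - (x - unitCurve N s) =
      unitCurve N t by abel, nt])
  have hY' := h (x + unitCurve N t) (by rw [sub_add_cancel_left, map_neg_eq_map, nt])
    (by rw [hz, show x + (unitCurve N t - unitCurve N s) - (x + unitCurve N t) =
      -unitCurve N s by abel, map_neg_eq_map, ns])
  rcases lt_trichotomy (area (z - x) (y - x)) 0 with hs | hs | hs
  · obtain ⟨θ, p, q, r, h1, h2, hp, hq, hr, hpqr, he⟩ := exists_combination hN hst hlt hY
      (by rwa [show y - (x - unitCurve N s) - unitCurve N s = y - x by abel])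
    have := arcFun_add_le_of_combination hN hst hmin h1 h2 hp hq hr hpqr he
    rwa [show y - (x - unitCurve N s) - unitCurve N s = y - x by abel,
      show unitCurve N t - (y - (x - unitCurve N s)) = z - y by rw [hz]; abel] at this
  · obtain ⟨κ, hκ⟩ : ∃ κ : ℝ, y = x + κ • (z - x) := by
      obtain ⟨V, hV, -⟩ := exists_area_eq N (z - x)
      have e := area_smul_eq (z - x) V (y - x)
      rw [hs, zero_smul, add_zero, hV] at e
      refine ⟨(N (z - x))⁻¹ * area (y - x) V, ?_⟩
      rw [mul_smul, ← e, smul_smul, inv_mul_cancel₀ (hN.pos h0).ne', one_smul]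
      abel
    have h1 : κ ≤ 1 := le_one_of_forall_norm_le hN hzx h0 fun v hv hv' => by
      rw [← hκ]; exact h v hv (by rwa [add_sub_cancel] at hv')
    have h2 : 1 - κ ≤ 1 := le_one_of_forall_norm_le hN (x := z) (d := x - z)
      (by rwa [map_sub_rev]) (by rwa [← neg_sub, neg_ne_zero]) fun v hv hv' => by
        rw [show z + (1 - κ) • (x - z) = y by rw [hκ]; module]
        exact h v (by rwa [add_sub_cancel] at hv') hv
    have := arcFun_add_le_of_combination hN hst hmin le_rfl hst.le (p := 1 - κ) (q := κ) (r := 0)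
      (by linarith) (by linarith) le_rfl (by ring) rfl
    rw [zero_smul, add_zero] at this
    rwa [show (1 - κ) • unitCurve N s + κ • unitCurve N t - unitCurve N s = y - x by
        rw [hκ, ← hd]; module,
      show unitCurve N t - ((1 - κ) • unitCurve N s + κ • unitCurve N t) = z - y by
        rw [show z - y = (1 - κ) • (z - x) by rw [hκ]; module, ← hd]; module] at this
  · obtain ⟨θ, p, q, r, h1, h2, hp, hq, hr, hpqr, he⟩ := exists_combination hN hst hlt
      (Y := x + unitCurve N t - y) (by rwa [map_sub_rev])
      (by
        rw [show x + unitCurve N t - y - unitCurve N s = (z - x) - (y - x) by rw [← hd]; abel,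
          area_sub_right, area_self]
        linarith)
    have := arcFun_add_le_of_combination hN hst hmin h1 h2 hp hq hr hpqr he
    rw [show x + unitCurve N t - y - unitCurve N s = z - y by rw [hz]; abel,
      show unitCurve N t - (x + unitCurve N t - y) = y - x by abel] at this
    linarith

end inside

section arcs

variable {N : Seminorm ℝ Plane}

lemma arcFun_neg (d : Plane) : arcFun N (-d) = arcFun N d := by
  have key : ∀ e, {l | ∃ s t, IsChord N e s t ∧ unitLength N s t = l} ⊆
      {l | ∃ s t, IsChord N (-e) s t ∧ unitLength N s t = l} := by
    rintro e _ ⟨s, t, h, rfl⟩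
    refine ⟨s + π, t + π, ⟨by linarith [h.le], by linarith [h.le_add_pi], ?_⟩,
      unitLength_add_pi h.le⟩
    rw [unitCurve_add_pi, unitCurve_add_pi, ← h.eq]
    abel
  have h := key (-d)
  rw [neg_neg] at h
  exact congrArg sInf (h.antisymm (key d))

lemma arcFun_le_unitLength (hN : IsPlaneNorm N) {s t : ℝ} (h : s ≤ t) :
    arcFun N (unitCurve N t - unitCurve N s) ≤ unitLength N s t := by
  set t' := toIcoMod two_pi_pos s t with ht'
  obtain ⟨h1, h2⟩ := toIcoMod_mem_Ico two_pi_pos s t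
  rw [← ht'] at h1 h2
  have hk : t' = t + ((-toIcoDiv two_pi_pos s t : ℤ) : ℝ) * (2 * π) := by
    rw [ht', toIcoMod, sub_eq_add_neg, zsmul_eq_mul, ← neg_mul, ← Int.cast_neg]
  have hc : unitCurve N t' = unitCurve N t := by rw [hk, unitCurve_add_int_mul]
  have ht : t' ≤ t := by
    by_contra hlt
    push Not at hlt
    rw [hk] at hlt h2
    have k1 : (0 : ℝ) < ((-toIcoDiv two_pi_pos s t : ℤ) : ℝ) := by
      by_contra hneg
      push Not at hneg
      nlinarith [pi_pos]
    have k2 : (1 : ℝ) ≤ ((-toIcoDiv two_pi_pos s t : ℤ) : ℝ) := by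
      exact_mod_cast Int.cast_pos.1 k1
    nlinarith [pi_pos]
  have hadd := unitLength_add hN h1 ht
  have hnn := unitLength_nonneg (N := N) t' t
  rw [← hc]
  refine le_trans ?_ (by linarith : unitLength N s t' ≤ unitLength N s t)
  rcases le_total t' (s + π) with hle | hle
  · exact arcFun_le ⟨h1, hle, rfl⟩
  · have e1 := unitLength_add hN (show s ≤ t' - π by linarith) (show t' - π ≤ s + π by linarith)
    have e2 := unitLength_add hN (show s ≤ s + π by linarith [pi_pos]) hle
    have n1 := unitLength_nonneg (N := N) s (t' - π)
    have n2 := unitLength_nonneg (N := N) (s + π) t'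
    have := arcFun_le (isChord_of_pi_lt (N := N) hle h2.le)
    linarith

/-- Lifting of paths in the unit circle to the angle. -/
lemma exists_angle_lift_unitInterval {δ : unitInterval → Plane} (hδ : Continuous δ)
    (hδN : ∀ r, N (δ r) = 1) : ∃ Γ : C(unitInterval, ℝ), ∀ r, δ r = unitCurve N (Γ r) := by
  let w : unitInterval → ℂ := fun r => Complex.equivRealProdCLM.symm (δ r 0, δ r 1)
  have hre : ∀ r, (w r).re = δ r 0 := fun _ => rfl
  have him : ∀ r, (w r).im = δ r 1 := fun _ => rfl
  have hwc : Continuous w :=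
    Complex.equivRealProdCLM.symm.continuous.comp
      (((EuclideanSpace.proj (𝕜 := ℝ) (0 : Fin 2)).continuous.comp hδ).prodMk
        ((EuclideanSpace.proj (𝕜 := ℝ) (1 : Fin 2)).continuous.comp hδ))
  have hw0 : ∀ r, w r ≠ 0 := by
    intro r h0
    have h1 : δ r = 0 := by
      ext i
      fin_cases i
      · exact (hre r).symm.trans (congrArg Complex.re h0)
      · exact (him r).symm.trans (congrArg Complex.im h0)
    have h2 := hδN r
    rw [h1, map_zero] at h2
    exact zero_ne_one h2
  have hn0 : ∀ r, (‖w r‖ : ℂ) ≠ 0 := fun r =>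
    Complex.ofReal_ne_zero.2 (norm_ne_zero_iff.2 (hw0 r))
  have hmem : ∀ r, w r / (‖w r‖ : ℂ) ∈ Submonoid.unitSphere ℂ := fun r =>
    mem_sphere_zero_iff_norm.2 (by
      rw [norm_div, Complex.norm_real, norm_norm, div_self (norm_ne_zero_iff.2 (hw0 r))])
  have hfc : Continuous fun r => (⟨w r / (‖w r‖ : ℂ), hmem r⟩ : Circle) :=
    Continuous.subtype_mk (hwc.div (Complex.continuous_ofReal.comp hwc.norm) hn0) _
  let f : C(unitInterval, Circle) := ⟨fun r => ⟨w r / (‖w r‖ : ℂ), hmem r⟩, hfc⟩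
  obtain ⟨e, he⟩ := Circle.exp_surjective (f 0)
  have hlift := Circle.isCoveringMap_exp.liftPath_lifts f e he.symm
  refine ⟨Circle.isCoveringMap_exp.liftPath f e he.symm, fun r => ?_⟩
  generalize Circle.isCoveringMap_exp.liftPath f e he.symm = Γ at hlift
  have h1 : (Circle.exp (Γ r) : ℂ) = w r / (‖w r‖ : ℂ) :=
    congrArg Subtype.val (congrFun hlift r)
  rw [Circle.coe_exp, eq_div_iff (hn0 r), mul_comm] at h1
  have h2 : δ r = ‖w r‖ • angleVec (Γ r) := by
    ext i
    fin_cases i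
    · have := congrArg Complex.re h1
      rw [Complex.re_ofReal_mul, Complex.exp_ofReal_mul_I_re, hre] at this
      exact this.symm
    · have := congrArg Complex.im h1
      rw [Complex.im_ofReal_mul, Complex.exp_ofReal_mul_I_im, him] at this
      exact this.symm
  have h3 := hδN r
  rw [h2, N.map_smul_nonneg (norm_nonneg _)] at h3
  rw [h2, unitCurve, eq_inv_of_mul_eq_one_left h3]

lemma exists_angle_lift (hN : IsPlaneNorm N) {γ : ℝ → Plane} {a b : ℝ} (hab : a ≤ b)
    (hγ : ContinuousOn γ (Icc a b)) (hγN : ∀ r ∈ Icc a b, N (γ r) = 1) :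
    ∃ φ : ℝ → ℝ, Continuous φ ∧ ∀ r ∈ Icc a b, γ r = unitCurve N (φ r) := by
  rcases hab.eq_or_lt with rfl | hlt
  · obtain ⟨θ, -, hθ⟩ := exists_unitCurve hN (γ a) 0
    rw [hγN a (left_mem_Icc.2 hab), one_smul] at hθ
    exact ⟨fun _ => θ, continuous_const, fun r hr => by
      rw [Icc_self, mem_singleton_iff] at hr; rw [hr]; exact hθ⟩
  have hba : 0 < b - a := sub_pos.2 hlt
  have hmem : ∀ r : unitInterval, a + (r : ℝ) * (b - a) ∈ Icc a b := fun r =>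
    ⟨by nlinarith [r.2.1], by nlinarith [r.2.2]⟩
  obtain ⟨Γ, hΓ⟩ := exists_angle_lift_unitInterval (N := N)
    (hγ.comp_continuous (by fun_prop) hmem) fun r => hγN _ (hmem r)
  refine ⟨fun x => Γ (projIcc 0 1 zero_le_one ((x - a) / (b - a))),
    Γ.continuous.comp (continuous_projIcc.comp (by fun_prop)), fun x hx => ?_⟩
  have hx' : (x - a) / (b - a) ∈ Icc (0 : ℝ) 1 :=
    ⟨div_nonneg (by linarith [hx.1]) hba.le, (div_le_one hba).2 (by linarith [hx.2])⟩
  have e : ((projIcc 0 1 zero_le_one ((x - a) / (b - a)) : unitInterval) : ℝ) =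
      (x - a) / (b - a) := congrArg Subtype.val (projIcc_of_mem _ hx')
  refine (congrArg γ ?_).trans (hΓ _)
  dsimp only
  rw [e, div_mul_cancel₀ _ hba.ne', add_sub_cancel]

/-- Every arc in a translate of the unit circle is at least as long as the shortest one. -/
lemma ofReal_arcFun_le_curveLength (hN : IsPlaneNorm N) {γ : ℝ → Plane} {v : Plane} {a b : ℝ}
    (hab : a ≤ b) (hγ : ContinuousOn γ (Icc a b)) (hinj : InjOn γ (Icc a b))
    (hγN : ∀ r ∈ Icc a b, N (γ r - v) = 1) :
    ENNReal.ofReal (arcFun N (γ b - γ a)) ≤ curveLength N γ a b := by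
  obtain ⟨φ, hφ, hφγ⟩ := exists_angle_lift hN hab (hγ.sub continuousOn_const) hγN
  have hγφ : ∀ r ∈ Icc a b, γ r = v + unitCurve N (φ r) := fun r hr => by
    rw [← hφγ r hr]; exact (add_sub_cancel v (γ r)).symm
  have hlen : curveLength N γ a b = curveLength N (unitCurve N ∘ φ) a b := by
    rw [curveLength_congr hγφ]
    exact curveLength_congr_norm fun s t => by simp
  have hφinj : InjOn φ (Icc a b) := fun r hr r' hr' h =>
    hinj hr hr' (by rw [hγφ r hr, hγφ r' hr', h])
  have hd : γ b - γ a = unitCurve N (φ b) - unitCurve N (φ a) := by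
    rw [hγφ b (right_mem_Icc.2 hab), hγφ a (left_mem_Icc.2 hab)]; abel
  rw [hlen]
  rcases hφ.continuousOn.strictMonoOn_of_injOn_Icc' hab hφinj with hm | hm
  · rw [curveLength_comp_monotone _ hab hm.monotoneOn hφ.continuousOn, ← ofReal_unitLength hN, hd]
    exact ENNReal.ofReal_le_ofReal (arcFun_le_unitLength hN
      (hm.monotoneOn (left_mem_Icc.2 hab) (right_mem_Icc.2 hab) hab))
  · rw [curveLength_comp_antitone _ hab hm.antitoneOn hφ.continuousOn, ← ofReal_unitLength hN, hd,
      ← arcFun_neg, neg_sub]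
    exact ENNReal.ofReal_le_ofReal (arcFun_le_unitLength hN
      (hm.antitoneOn (left_mem_Icc.2 hab) (right_mem_Icc.2 hab) hab))

end arcs

section body

variable {C : Set Plane}

lemma IsSymmPlaneBody.mem_nhds_zero (hC : IsSymmPlaneBody C) : C ∈ 𝓝 (0 : Plane) := by
  obtain ⟨a, ha⟩ := hC.interior_nonempty
  have hneg : -a ∈ C := by
    rw [← hC.neg_eq, Set.mem_neg, neg_neg]; exact interior_subset ha
  have := hC.convex.combo_interior_self_mem_interior ha hneg (a := 1 / 2) (b := 1 / 2)
    (by norm_num) (by norm_num) (by norm_num)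
  rw [smul_neg, add_neg_cancel] at this
  exact mem_interior_iff_mem_nhds.1 this

lemma IsSymmPlaneBody.balanced (hC : IsSymmPlaneBody C) : Balanced ℝ C := by
  rw [balanced_iff_smul_mem]
  intro r hr x hx
  rw [Real.norm_eq_abs, abs_le] at hr
  have hneg : -x ∈ C := by rw [← hC.neg_eq, Set.mem_neg, neg_neg]; exact hx
  have := hC.convex hx hneg (a := (1 + r) / 2) (b := (1 - r) / 2) (by linarith) (by linarith)
    (by ring)
  rwa [show ((1 + r) / 2) • x + ((1 - r) / 2) • -x = r • x by module] at this

/-- The norm with unit disk `C`. -/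
noncomputable def bodySeminorm (hC : IsSymmPlaneBody C) : Seminorm ℝ Plane :=
  gaugeSeminorm hC.balanced hC.convex (absorbent_nhds_zero hC.mem_nhds_zero)

lemma bodySeminorm_sub (hC : IsSymmPlaneBody C) (p q : Plane) :
    bodySeminorm hC (q - p) = bodyDist C p q := rfl

lemma isPlaneNorm_bodySeminorm (hC : IsSymmPlaneBody C) : IsPlaneNorm (bodySeminorm hC) where
  continuous := continuous_gauge hC.convex hC.mem_nhds_zero
  eq_zero _ h := (gauge_eq_zero (absorbent_nhds_zero hC.mem_nhds_zero)
    ((NormedSpace.isVonNBounded_iff ℝ).2 hC.isCompact.isBounded)).1 h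

lemma mem_vadd_iff (hC : IsSymmPlaneBody C) (v w : Plane) :
    w ∈ v +ᵥ C ↔ bodySeminorm hC (w - v) ≤ 1 := by
  rw [mem_vadd_set_iff_neg_vadd_mem, vadd_eq_add, neg_add_eq_sub]
  exact (hC.isCompact.isClosed.closure_eq ▸
    gauge_le_one_iff_mem_closure hC.convex hC.mem_nhds_zero).symm

lemma mem_frontier_vadd_iff (hC : IsSymmPlaneBody C) (v w : Plane) :
    w ∈ frontier (v +ᵥ C) ↔ bodySeminorm hC (w - v) = 1 := by
  have h : frontier (v +ᵥ C) = v +ᵥ frontier C :=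
    ((Homeomorph.addLeft v).image_frontier C).symm
  rw [h, mem_vadd_set_iff_neg_vadd_mem, vadd_eq_add, neg_add_eq_sub]
  exact (gauge_eq_one_iff_mem_frontier hC.convex hC.mem_nhds_zero).symm

lemma bodyLength_eq_curveLength (hC : IsSymmPlaneBody C) (γ : ℝ → Plane) (a b : ℝ) :
    bodyLength C γ a b = curveLength (bodySeminorm hC) γ a b := by
  unfold bodyLength curveLength eVariationOn
  simp only [SeminormSpace.edist_eq, bodySeminorm_sub]

lemma isLeast_arcLengths (hC : IsSymmPlaneBody C) {p q : Plane} (h : bodyDist C p q ≤ 2) :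
    IsLeast (arcLengths C p q) (ENNReal.ofReal (arcFun (bodySeminorm hC) (q - p))) := by
  have hN := isPlaneNorm_bodySeminorm hC
  constructor
  · obtain ⟨s, t, hst, he⟩ := exists_unitLength_eq_arcFun hN (d := q - p) h
    set c := unitCurve (bodySeminorm hC)
    refine ⟨p - c s, fun r => p - c s + c r, s, t,
      ⟨hst.le, (continuous_const.add (continuous_unitCurve hN)).continuousOn, ?_,
        sub_add_cancel _ _, ?_, fun r _ => ?_⟩, ?_⟩
    · have hinj : ∀ r ∈ Icc s t, ∀ r' ∈ Icc s t, r ≤ r' → c r = c r' → r = r' :=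
        fun r hr r' hr' hle => unitCurve_injective hN hle
          (by linarith [hr.1, hr'.2, hst.le_add_pi, pi_pos])
      intro r hr r' hr' hrr
      have hrr' := add_left_cancel hrr
      rcases le_total r r' with hle | hle
      · exact hinj r hr r' hr' hle hrr'
      · exact (hinj r' hr' r hr hle hrr'.symm).symm
    · show p - c s + c t = q
      rw [sub_add_eq_add_sub, add_sub_assoc, hst.eq, add_sub_cancel]
    · rw [mem_frontier_vadd_iff hC, add_sub_cancel_left, norm_unitCurve hN]
    · rw [bodyLength_eq_curveLength hC, ← he, ofReal_unitLength hN]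
      exact curveLength_congr_norm fun a b => by rw [add_sub_add_left_eq_sub]
  · rintro _ ⟨v, γ, a, b, ⟨hab, hγ, hinj, rfl, rfl, hγC⟩, rfl⟩
    rw [bodyLength_eq_curveLength hC]
    exact ofReal_arcFun_le_curveLength hN hab hγ hinj
      fun r hr => (mem_frontier_vadd_iff hC v _).1 (hγC r hr)

lemma arcDist_eq (hC : IsSymmPlaneBody C) {p q : Plane} (h : bodyDist C p q ≤ 2) :
    arcDist C p q = ENNReal.ofReal (arcFun (bodySeminorm hC) (q - p)) :=
  (isLeast_arcLengths hC h).csInf_eq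

lemma arcDistAttained (hC : IsSymmPlaneBody C) {p q : Plane} (h : bodyDist C p q ≤ 2) :
    ArcDistAttained C p q := by
  rw [ArcDistAttained, arcDist_eq hC h]
  exact ⟨isLeast_arcLengths hC h, ENNReal.ofReal_ne_top⟩

lemma mem_spindle_iff (hC : IsSymmPlaneBody C) {x y z : Plane} :
    y ∈ spindle C x z ↔ ∀ v, bodySeminorm hC (x - v) ≤ 1 → bodySeminorm hC (z - v) ≤ 1 →
      bodySeminorm hC (y - v) ≤ 1 := by
  simp only [spindle, mem_iInter, mem_vadd_iff hC]

lemma isClosed_spindle (hC : IsSymmPlaneBody C) (x z : Plane) : IsClosed (spindle C x z) :=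
  isClosed_iInter fun v => isClosed_iInter fun _ => isClosed_iInter fun _ =>
    hC.isCompact.isClosed.vadd v

/-- A point that is not interior to the spindle is not interior to some translate of `C`
containing the endpoints of the spindle. -/
lemma exists_of_notMem_interior_spindle (hC : IsSymmPlaneBody C) {x y z : Plane}
    (hxz : bodyDist C x z ≤ 2) (hy : y ∉ interior (spindle C x z)) :
    ∃ v, bodySeminorm hC (x - v) ≤ 1 ∧ bodySeminorm hC (z - v) ≤ 1 ∧
      1 ≤ bodySeminorm hC (y - v) := by
  have hN := isPlaneNorm_bodySeminorm hC
  by_contra! hlt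
  set N := bodySeminorm hC with hNdef
  have hcont : ∀ p : Plane, Continuous fun v => N (p - v) := fun p =>
    hN.continuous.comp (continuous_const.sub continuous_id)
  set K : Set Plane := {v | N (x - v) ≤ 1} ∩ {v | N (z - v) ≤ 1} with hK
  have hKc : IsCompact K := by
    refine (hC.isCompact.vadd x).of_isClosed_subset ((isClosed_le (hcont x) continuous_const).inter
      (isClosed_le (hcont z) continuous_const)) fun v hv => ?_
    rw [mem_vadd_iff hC, map_sub_rev]
    exact hv.1
  have hKne : K.Nonempty := by
    have hd : N (z - x) ≤ 2 := hxz
    refine ⟨(1 / 2 : ℝ) • (x + z), ?_, ?_⟩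
    · rw [mem_ofPred_eq, show x - (1 / 2 : ℝ) • (x + z) = (-1 / 2 : ℝ) • (z - x) by module,
        map_smul_eq_mul]
      norm_num
      linarith
    · rw [mem_ofPred_eq, show z - (1 / 2 : ℝ) • (x + z) = (1 / 2 : ℝ) • (z - x) by module,
        map_smul_eq_mul]
      norm_num
      linarith
  obtain ⟨m, hm, hmax⟩ := hKc.exists_isMaxOn hKne (hcont y).continuousOn
  have hm1 := hlt m hm.1 hm.2
  refine hy (mem_interior.2 ⟨{w | N (y - w) < 1 - N (y - m)}, fun w hw => ?_,
    isOpen_lt (hcont y) continuous_const, ?_⟩)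
  · rw [mem_spindle_iff hC]
    intro v hv hv'
    have h1 : N (y - v) ≤ N (y - m) := hmax (show v ∈ K from ⟨hv, hv'⟩)
    have h2 := map_sub_le_add N (y - v) (y - w)
    rw [sub_sub_sub_cancel_left] at h2
    have h3 : N (y - w) < 1 - N (y - m) := hw
    linarith
  · show N (y - y) < 1 - N (y - m)
    rw [sub_self, map_zero]
    linarith

end body

theorem mainTheorem8 (C : Set Plane) (hC : IsSymmPlaneBody C) (x y z : Plane)
    (hxy : bodyDist C x y ≤ 2) (hyz : bodyDist C y z ≤ 2) (hxz : bodyDist C x z ≤ 2) :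
    (ArcDistAttained C x y ∧ ArcDistAttained C y z ∧ ArcDistAttained C x z) ∧
    (y ∈ interior (spindle C x z) → arcDist C x y + arcDist C y z ≤ arcDist C x z) ∧
    (y ∈ frontier (spindle C x z) → arcDist C x y + arcDist C y z = arcDist C x z) ∧
    (y ∉ spindle C x z → IsSmoothBody C →
      arcDist C x y + arcDist C y z ≥ arcDist C x z) := by
  have hN := isPlaneNorm_bodySeminorm hC
  have hle : y ∈ spindle C x z → arcDist C x y + arcDist C y z ≤ arcDist C x z := by
    intro hy
    rw [arcDist_eq hC hxy, arcDist_eq hC hyz, arcDist_eq hC hxz,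
      ← ENNReal.ofReal_add (arcFun_nonneg _) (arcFun_nonneg _)]
    exact ENNReal.ofReal_le_ofReal (arcFun_add_le_of_forall hN hxz ((mem_spindle_iff hC).1 hy))
  have hge : y ∉ interior (spindle C x z) →
      arcDist C x z ≤ arcDist C x y + arcDist C y z := by
    intro hy
    obtain ⟨v, hx, hz, hyv⟩ := exists_of_notMem_interior_spindle hC hxz hy
    rw [arcDist_eq hC hxy, arcDist_eq hC hyz, arcDist_eq hC hxz,
      ← ENNReal.ofReal_add (arcFun_nonneg _) (arcFun_nonneg _)]
    exact ENNReal.ofReal_le_ofReal (arcFun_le_add hN hx hz hyv hxy hyz)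
  refine ⟨⟨arcDistAttained hC hxy, arcDistAttained hC hyz, arcDistAttained hC hxz⟩,
    fun hy => hle (interior_subset hy), fun hy => ?_,
    fun hy _ => hge fun h => hy (interior_subset h)⟩
  exact le_antisymm (hle ((isClosed_spindle hC x z).frontier_subset hy)) (hge hy.2)
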